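/- Consider a finite simply connected patch of the $\{5,4\}$ tiling of the hyperbolic plane (pentagons, four around each vertex), grown from one pentagon by repeatedly gluing a pentagon either along one boundary edge, or along two consecutive boundary edges whose common vertex already has three pentagons. Put on every pentagon the six-leg tensor of the five-qubit Laflamme code (one logical leg, one leg per edge) and contract the legs along shared edges; this gives the HaPPY encoding map $V$ from the bulk qubits (one per pentagon) to the boundary qubits (one per boundary edge), an isometry up to normalisation. Number the $N$ boundary edges $1,\dots,N$ along the boundary, starting at a boundary vertex called the pivot, and let $\gamma_{2k-1}=Z_1\cdots Z_{k-1}X_k$ and $\gamma_{2k}=Z_1\cdots Z_{k-1}Y_k$ be the corresponding Jordan--Wigner Majorana operators, where node $2k-1$ and node $2k$ sit on edge $k$. Let $A$ be a set of consecutive boundary edges in this numbering (so that the pivot is not in the interior of $A$), and let $a$ be the entanglement wedge of $A$: a set of bulk qubits such that complementary recovery holds, i.e. every operator on $a$ is recoverable on $A$ and every operator on the complementary wedge $a^c$ is recoverable on $A^c$ (an algebra $\mathcal B(\mathcal H_a)$ is recoverable on $A$ if there is an injective unital $*$-homomorphism $\iota:\mathcal B(\mathcal H_a)\to\mathcal B(\mathcal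 H_A)$ with $(\iota(O)\otimes 1)V=V(O\otimes 1)$ for all $O$). Then the encoded basis states $V|b\rangle$, $b\in\{0,1\}^{\mathrm{bulk}}$, are Majorana dimer states with a common set of dimers: there are a partition $M$ of the $2N$ Majorana nodes into pairs $(k,l)$, $k<l$ (the dimers), and signs $p_{k,l}(b)=\pm1$ (the dimer parities) such that $V|b\rangle\neq 0$ and $(\gamma_k+\mathrm i\,p_{k,l}(b)\,\gamma_l)V|b\rangle=0$ for all $(k,l)\in M$ and all $b$. Moreover, there is a collection $L\subseteq M$ of dimers that begin and end in $A$ whose parities are in one-to-one correspondence with the basis state of the bulk qubits in $a$, independently of the state in the complementary wedge: for all $b,b'$, the parities satisfy $p_{k,l}(b)=p_{k,l}(b')$ for all $(k,l)\in L$ if and only if $b$ and $b'$ agree on $a$. In particular, the parities of the dimers in $L$ differ between any two codespace basis states that differ only in the bulk qubits of $a$, whatever their common state in $a^c$ is. -/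

import Mathlib

open scoped Matrix

namespace HaPPY

noncomputable section

/-! ### Qubits, Pauli strings and Majorana operators -/

/-- Computational basis labels of a register of qubits indexed by `ι`. -/
abbrev Config (ι : Type) : Type := ι → Fin 2

/-- A (not necessarily normalised) vector of `N` qubits, in the computational basis. -/
abbrev QState (N : ℕ) : Type := Config (Fin N) → ℂ

/-- The Pauli matrix `X`. -/
def pauliX : Matrix (Fin 2) (Fin 2) ℂ := !![0, 1; 1, 0]

/-- The Pauli matrix `Y`. -/
def pauliY : Matrix (Fin 2) (Fin 2) ℂ := !![0, -Complex.I; Complex.I, 0]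

/-- The Pauli matrix `Z`. -/
def pauliZ : Matrix (Fin 2) (Fin 2) ℂ := !![1, 0; 0, -1]

/-- The tensor product `⨂ i, f i` of one-qubit operators. -/
def tensorOp {N : ℕ} (f : Fin N → Matrix (Fin 2) (Fin 2) ℂ) :
    Matrix (Config (Fin N)) (Config (Fin N)) ℂ :=
  Matrix.of fun s t => ∏ i, f i (s i) (t i)

/-- The qubit (edge) carrying a Majorana node: nodes `2 i` and `2 i + 1` sit on qubit `i`. -/
def site {N : ℕ} (k : Fin (2 * N)) : Fin N := ⟨k.val / 2, by omega⟩

/-- Jordan-Wigner: with nodes and qubits counted from `0`,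
`γ (2 i) = Z₀ ⋯ Z_{i-1} X_i` and `γ (2 i + 1) = Z₀ ⋯ Z_{i-1} Y_i`. The pivot lies just before
qubit `0`. -/
def majorana {N : ℕ} (k : Fin (2 * N)) : Matrix (Config (Fin N)) (Config (Fin N)) ℂ :=
  tensorOp fun j =>
    if j < site k then pauliZ
    else if j = site k then (if k.val % 2 = 0 then pauliX else pauliY)
    else 1

/-! ### Majorana dimer states -/

/-- A dimer `(k, l)`, a pair of Majorana nodes, written with `k < l`. -/
abbrev Dimer (N : ℕ) : Type := Fin (2 * N) × Fin (2 * N)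

/-- A set of dimers that joins the `2 N` Majorana nodes in pairs. -/
def IsDimerPairing {N : ℕ} (M : Finset (Dimer N)) : Prop :=
  (∀ d ∈ M, d.1 < d.2) ∧ ∀ k : Fin (2 * N), ∃! d : Dimer N, d ∈ M ∧ (d.1 = k ∨ d.2 = k)

/-- `ψ` is the Majorana dimer state with dimers `M` and dimer parities `p`:
`(γ_k + i p_{k,l} γ_l) ψ = 0` for every dimer `(k, l)`. -/
def IsDimerState {N : ℕ} (ψ : QState N) (M : Finset (Dimer N)) (p : Dimer N → ℤˣ) : Prop :=
  ψ ≠ 0 ∧ IsDimerPairing M ∧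
    ∀ d ∈ M, (majorana d.1 + (Complex.I * (((p d : ℤˣ) : ℤ) : ℂ)) • majorana d.2) *ᵥ ψ = 0

/-- Both ends of the dimer lie on qubits of `A`. -/
def Dimer.Within {N : ℕ} (d : Dimer N) (A : Finset (Fin N)) : Prop :=
  site d.1 ∈ A ∧ site d.2 ∈ A

/-! ### The logical states of one pentagon -/

/-- Four times the amplitude of `s : Fin 5 → Fin 2` in the logical basis state `b̄` of the five-qubit
Laflamme code, where `0̄ = ¼ ∑_{|s| even} (-1)^{∑ s_i s_{i+1}} |s⟩` and `1̄ = X^{⊗ 5} 0̄`. -/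
def tileSign (b : Fin 2) (s : Fin 5 → Fin 2) : ℤ :=
  if ∑ i, s i = b then (-1) ^ (b.val + ∑ i : Fin 5, (s i).val * (s (i + 1)).val) else 0

/-- The logical basis state `b̄` of one pentagon, its five edges listed in cyclic order, as the
six-leg tensor of the Laflamme code. It is invariant under rotations of the pentagon. -/
def tile (b : Fin 2) : QState 5 := fun s => (1 / 4) * (tileSign b s : ℂ)

/-! ### The pentagon states are dimer states -/

/-- The sign that a Majorana operator `γ_k` attaches to a basis state. -/
def majoranaSign {N : ℕ} (k : Fin (2 * N)) (s : Config (Fin N)) : ℤ :=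
  ∏ j, if j < site k then (-1) ^ (s j).val
    else if j = site k ∧ k.val % 2 = 1 then (-1) ^ ((s j).val + 1) else 1

/-- Action of a Majorana operator on amplitudes. -/
theorem majorana_mulVec {N : ℕ} (k : Fin (2 * N)) (ψ : QState N) (s : Config (Fin N)) :
    (majorana k *ᵥ ψ) s =
      (if k.val % 2 = 0 then 1 else Complex.I) * (majoranaSign k s : ℂ) *
        ψ (fun j => if j = site k then 1 - s j else s j) := by
  rw [Matrix.mulVec, dotProduct,
    Finset.sum_eq_single (fun j => if j = site k then 1 - s j else s j)]
  · congr 1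
    simp only [majorana, tensorOp, Matrix.of_apply]
    have h1 : (if k.val % 2 = 0 then 1 else Complex.I : ℂ) =
        ∏ j : Fin N, if j = site k then (if k.val % 2 = 0 then 1 else Complex.I) else 1 := by simp
    rw [h1, majoranaSign, Int.cast_prod, ← Finset.prod_mul_distrib]
    refine Finset.prod_congr rfl fun j _ => ?_
    generalize s j = x
    by_cases hj : j = site k
    · rcases Nat.mod_two_eq_zero_or_one k.val with hk | hk <;> fin_cases x <;>
        simp [hj, hk, pauliX, pauliY]
    · by_cases hl : j < site k <;> fin_cases x <;> simp [hj, hl, pauliZ, Matrix.one_apply]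
  · intro t _ ht
    have h : ∃ j, (if j < site k then pauliZ else if j = site k then
        (if k.val % 2 = 0 then pauliX else pauliY) else 1) (s j) (t j) = 0 := by
      by_contra! hc
      refine ht (funext fun j => ?_)
      have hj := hc j
      revert hj
      generalize s j = x
      generalize t j = y
      by_cases h : j = site k
      · rcases Nat.mod_two_eq_zero_or_one k.val with hk | hk <;> fin_cases x <;> fin_cases y <;>
          simp [h, hk, pauliX, pauliY]
      · by_cases hl : j < site k <;> fin_cases x <;> fin_cases y <;> simp [h, hl, pauliZ]
    obtain ⟨j, hj⟩ := h
    have h0 : majorana k s t = 0 := Finset.prod_eq_zero (Finset.mem_univ j) hj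
    rw [h0, zero_mul]
  · exact fun h => absurd (Finset.mem_univ _) h

/-- The logical basis states of the pentagon are the Majorana dimer states whose dimers join
opposite nodes; the parities are all `1` for `0̄`, and for `1̄` the three dimers
`(0, 5), (2, 7), (4, 9)` have parity `-1`. -/
theorem tile_isDimerState (b : Fin 2) :
    IsDimerState (N := 5) (tile b) {(0, 5), (1, 6), (2, 7), (3, 8), (4, 9)}
      (fun d => if d.1.val % 2 = 0 then (-1) ^ b.val else 1) := by
  have key : ∀ d ∈ ({(0, 5), (1, 6), (2, 7), (3, 8), (4, 9)} : Finset (Dimer 5)),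
      ∀ (b : Fin 2) (s : Fin 5 → Fin 2),
        d.1.val % 2 + d.2.val % 2 = 1 ∧
        majoranaSign d.1 s * tileSign b (fun j => if j = site d.1 then 1 - s j else s j) =
          (if d.1.val % 2 = 0 then (-1) ^ b.val else -1) *
            (majoranaSign d.2 s *
              tileSign b (fun j => if j = site d.2 then 1 - s j else s j)) := by
    decide +kernel
  refine ⟨fun h => ?_, ⟨by decide, fun k => ?_⟩, fun d hd => ?_⟩
  · have := congrFun h ![b, 0, 0, 0, 0]
    revert this
    fin_cases b <;> simp [tile, tileSign, Fin.sum_univ_five]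
  · revert k
    unfold ExistsUnique
    decide +kernel
  · funext s
    obtain ⟨h1, h2⟩ := key d hd b s
    rw [Matrix.add_mulVec, Matrix.smul_mulVec, Pi.add_apply, Pi.smul_apply, majorana_mulVec,
      majorana_mulVec, tile, tile]
    have h3 := congrArg (Int.cast : ℤ → ℂ) h2
    push_cast at h3
    rcases Nat.mod_two_eq_zero_or_one d.1.val with hk | hk
    · have hl : d.2.val % 2 = 1 := by omega
      simp only [hk, hl, if_true, one_ne_zero, if_false, smul_eq_mul, Pi.zero_apply] at h3 ⊢
      push_cast
      linear_combination (1 / 4 : ℂ) * h3 + (1 / 4 : ℂ) * (-1) ^ b.val *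
        (majoranaSign d.2 s : ℂ) *
        (tileSign b (fun j => if j = site d.2 then 1 - s j else s j) : ℂ) * Complex.I_mul_I
    · have hl : d.2.val % 2 = 0 := by omega
      simp only [hk, hl, if_true, one_ne_zero, if_false, smul_eq_mul, Pi.zero_apply] at h3 ⊢
      push_cast
      linear_combination (1 / 4 : ℂ) * Complex.I * h3

/-! ### Patches of the `{5,4}` tiling -/

/-- `Patch m c`: a simply connected patch of `m` pentagons of the `{5,4}` tiling, grown from a
single pentagon by gluing further pentagons to its boundary. The boundary edges are numbered
`0, 1, …` counterclockwise, starting at the pivot (a vertex of the boundary); entry `j` of `c` is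
the number of pentagons meeting at the starting vertex of boundary edge `j`. Four pentagons meet at
each vertex of the tiling, so a vertex becomes interior once it has four pentagons.

* `seed`: one pentagon.
* `movePivot`: the pivot moves across one edge, so edge `0` becomes the last edge.
* `glueEdge`: a pentagon is glued along edge `0`, which is replaced by the other four edges.
  Both ends of edge `0` stay on the boundary.
* `glueCorner`: edges `0` and `1` meet in a vertex with three pentagons, and the missing fourth
  pentagon, which has both edges as sides, is glued in; the two edges are replaced by its other
  three edges. -/
inductive Patch : ℕ → List ℕ → Type
  | seed : Patch 1 [1, 1, 1, 1, 1]
  | movePivot {m d : ℕ} {c : List ℕ} (P : Patch m (d :: c)) : Patch m (c ++ [d])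
  | glueEdge {m d e : ℕ} {c : List ℕ} (P : Patch m (d :: e :: c)) (hd : d ≤ 2) (he : e ≤ 2) :
      Patch (m + 1) ((d + 1) :: 1 :: 1 :: 1 :: (e + 1) :: c)
  | glueCorner {m d e : ℕ} {c : List ℕ} (P : Patch m (d :: 3 :: e :: c)) (hd : d ≤ 2)
      (he : e ≤ 2) : Patch (m + 1) ((d + 1) :: 1 :: 1 :: (e + 1) :: c)

/-- The contracted tensor network: `P.amp b s` is the amplitude of the boundary basis state `s`
(listed from the pivot on) when the pentagons carry the logical basis states `b̄`. Pentagon `0` is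
the one glued last. Contraction of two legs is summation over their common index; the legs of a
glued pentagon appear in its own cyclic order. On lists of a wrong length the value is irrelevant
(`0`). -/
def Patch.amp : {m : ℕ} → {c : List ℕ} → Patch m c → Config (Fin m) → List (Fin 2) → ℂ
  | _, _, .seed, b, [s₀, s₁, s₂, s₃, s₄] => tile (b 0) ![s₀, s₁, s₂, s₃, s₄]
  | _, _, .movePivot P, b, s₀ :: s =>
      P.amp b ((s₀ :: s).getLast (List.cons_ne_nil s₀ s) :: (s₀ :: s).dropLast)
  | _, _, .glueEdge P _ _, b, s₀ :: s₁ :: s₂ :: s₃ :: s =>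
      ∑ x : Fin 2, tile (b 0) ![x, s₀, s₁, s₂, s₃] * P.amp (Fin.tail b) (x :: s)
  | _, _, .glueCorner P _ _, b, s₀ :: s₁ :: s₂ :: s =>
      ∑ x : Fin 2, ∑ y : Fin 2,
        tile (b 0) ![y, x, s₀, s₁, s₂] * P.amp (Fin.tail b) (x :: y :: s)
  | _, _, _, _, _ => 0

/-- The bulk-to-boundary map `V` of the HaPPY code on the patch, up to a positive constant factor
(which makes it an isometry and is irrelevant below): column `b` is the boundary state that encodes
the bulk basis state `b`. -/
def Patch.encoding {m : ℕ} {c : List ℕ} (P : Patch m c) :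
    Matrix (Config (Fin c.length)) (Config (Fin m)) ℂ :=
  Matrix.of fun s b => P.amp b (List.ofFn s)

/-- The basis state of the codespace encoding the bulk basis state `b`. -/
def Patch.codeState {m : ℕ} {c : List ℕ} (P : Patch m c) (b : Config (Fin m)) :
    QState c.length :=
  fun s => P.encoding s b

/-! ### Complementary recovery and entanglement wedges -/

/-- The operator `O ⊗ 1` on the register `Fin N`, where `O` acts on the qubits in `S`. -/
def extendOp {N : ℕ} (S : Finset (Fin N)) (O : Matrix (Config S) (Config S) ℂ) :
    Matrix (Config (Fin N)) (Config (Fin N)) ℂ :=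
  Matrix.of fun s t => if ∀ i, i ∉ S → s i = t i then O (fun i => s i) (fun i => t i) else 0

/-- The algebra of all operators on the bulk qubits in `a` is recoverable from the boundary qubits
in `A`: there is a faithful unital `*`-homomorphism `ι` into the operators on `A` with
`(ι(O) ⊗ 1) V = V (O ⊗ 1)`. -/
def Recoverable {m N : ℕ} (V : Matrix (Config (Fin N)) (Config (Fin m)) ℂ)
    (A : Finset (Fin N)) (a : Finset (Fin m)) : Prop :=
  ∃ ι : Matrix (Config a) (Config a) ℂ →⋆ₐ[ℂ] Matrix (Config A) (Config A) ℂ,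
    Function.Injective ι ∧ ∀ O, extendOp A (ι O) * V = V * extendOp a O

/-- Complementary recovery: `a` is the entanglement wedge of the boundary region `A` if `a` is
recoverable from `A` and the complementary bulk region is recoverable from the complement of `A`. -/
def IsEntanglementWedge {m N : ℕ} (V : Matrix (Config (Fin N)) (Config (Fin m)) ℂ)
    (A : Finset (Fin N)) (a : Finset (Fin m)) : Prop :=
  Recoverable V A a ∧ Recoverable V Aᶜ aᶜ

end

end HaPPY

namespace HaPPY

/-! ### Algebra of product operators -/

/-! The proof has two halves: the code states are dimer states with common dimers, and the dimers
inside `A` carry exactly the information of `a`.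

For the first half, it is enough that all code states have definite fermion parity and that, for a
fixed involution `σ` of the nodes, `γ_k` and `γ_{σ k}` act proportionally on each of them
(`IsPairedState`). The constant of proportionality then squares to `-1`, because the two operators
anticommute, and its sign is the dimer parity. Paired states are built by induction on the patch.
Moving the pivot only relabels the nodes, up to the total parity. Gluing a pentagon extends each
dimer ending on a contracted edge along a dimer of the pentagon, and the remaining dimers of the
pentagon are added. The bulk values change only the constants, so `σ` is common to all of them
(`Patch.exists_pairing`).

For the second half, `L` consists of all dimers of `M` with both ends in `A`. Since `A` is an
interval, the Jordan–Wigner strings of such a dimer cancel outside `A`, so its bilinear is supported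
on `A`. If `b` and `b'` agree on `a`, recovery on `Aᶜ` gives an operator on `Aᶜ` taking `V|b⟩` to
`V|b'⟩`. It commutes with these bilinears, so the parities agree (`parity_eq_of_agree`).

Conversely, suppose that the parities in `L` agree but `b` and `b'` differ on `a`. Every dimer whose
parity changes has an end outside `A`. The product of one Majorana operator at such an end of each
of them takes `V|b⟩` to a multiple of `V|b'⟩`, since a dimer state is fixed up to a factor by its
dimers and parities (`exists_smul_of_mem_dimerEigenspace`). On `A` this product is `1` or `Z` on
every qubit, and the total parity removes the `Z`s. So an operator trivial on `A` relates the two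
states, while recovery on `A` provides an operator on `A` that fixes one and kills the other
(`agree_of_parity_eq`). -/

theorem tensorOp_mul {N : ℕ} (f g : Fin N → Matrix (Fin 2) (Fin 2) ℂ) :
    tensorOp f * tensorOp g = tensorOp fun i => f i * g i := by
  ext s u
  simp only [tensorOp, Matrix.mul_apply, Matrix.of_apply, ← Finset.prod_mul_distrib]
  rw [Finset.prod_univ_sum, Fintype.piFinset_univ]

theorem tensorOp_smul {N : ℕ} (r : Fin N → ℂ) (f : Fin N → Matrix (Fin 2) (Fin 2) ℂ) :
    tensorOp (fun i => r i • f i) = (∏ i, r i) • tensorOp f := by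
  ext s u
  simp [tensorOp, Finset.prod_mul_distrib]

theorem tensorOp_one {N : ℕ} : tensorOp (fun _ : Fin N => 1) = 1 := by
  ext s u
  by_cases h : s = u
  · subst h; simp [tensorOp]
  · obtain ⟨i, hi⟩ := Function.ne_iff.mp h
    simp only [tensorOp, Matrix.of_apply, Matrix.one_apply_ne h]
    exact Finset.prod_eq_zero (Finset.mem_univ i) (Matrix.one_apply_ne hi)

/-- Product operators that anticommute on one qubit and commute on the others anticommute. -/
theorem tensorOp_anticommute {N : ℕ} {f g : Fin N → Matrix (Fin 2) (Fin 2) ℂ} (i₀ : Fin N)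
    (h₀ : f i₀ * g i₀ = -(g i₀ * f i₀)) (h : ∀ i ≠ i₀, f i * g i = g i * f i) :
    tensorOp f * tensorOp g = -(tensorOp g * tensorOp f) := by
  rw [tensorOp_mul, tensorOp_mul]
  have h1 : (fun i => f i * g i) =
      fun i => (if i = i₀ then -1 else 1 : ℂ) • (g i * f i) := by
    funext i
    by_cases hi : i = i₀
    · subst hi; simp [h₀]
    · simp [hi, h i hi]
  rw [h1, tensorOp_smul]
  simp

theorem pauliX_mul_self : pauliX * pauliX = 1 := by
  ext i j; fin_cases i <;> fin_cases j <;> simp [pauliX, Matrix.mul_apply]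

theorem pauliY_mul_self : pauliY * pauliY = 1 := by
  ext i j; fin_cases i <;> fin_cases j <;> simp [pauliY, Matrix.mul_apply]

theorem pauliZ_mul_self : pauliZ * pauliZ = 1 := by
  ext i j; fin_cases i <;> fin_cases j <;> simp [pauliZ, Matrix.mul_apply]

theorem pauliX_mul_pauliY : pauliX * pauliY = -(pauliY * pauliX) := by
  ext i j; fin_cases i <;> fin_cases j <;> simp [pauliX, pauliY, Matrix.mul_apply]

theorem pauliX_mul_pauliZ : pauliX * pauliZ = -(pauliZ * pauliX) := by
  ext i j; fin_cases i <;> fin_cases j <;> simp [pauliX, pauliZ, Matrix.mul_apply]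

theorem pauliY_mul_pauliZ : pauliY * pauliZ = -(pauliZ * pauliY) := by
  ext i j; fin_cases i <;> fin_cases j <;> simp [pauliY, pauliZ, Matrix.mul_apply]

/-- The one-qubit factors of a Majorana operator. -/
noncomputable def majoranaFactor {N : ℕ} (k : Fin (2 * N)) (j : Fin N) :
    Matrix (Fin 2) (Fin 2) ℂ :=
  if j < site k then pauliZ
  else if j = site k then (if k.val % 2 = 0 then pauliX else pauliY)
  else 1

theorem majorana_eq {N : ℕ} (k : Fin (2 * N)) : majorana k = tensorOp (majoranaFactor k) := rfl

theorem majoranaFactor_mul_self {N : ℕ} (k : Fin (2 * N)) (j : Fin N) :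
    majoranaFactor k j * majoranaFactor k j = 1 := by
  unfold majoranaFactor
  split_ifs <;> simp [pauliX_mul_self, pauliY_mul_self, pauliZ_mul_self]

theorem majorana_mul_self {N : ℕ} (k : Fin (2 * N)) : majorana k * majorana k = 1 := by
  rw [majorana_eq, tensorOp_mul]
  simp_rw [majoranaFactor_mul_self]
  exact tensorOp_one

/-- For `k < l` the one-qubit factors commute except on the qubit of `k`. There `X` or `Y` meets the
string `Z` of `l`, or `X` meets `Y` if both nodes share the qubit. -/
theorem majorana_anticommute {N : ℕ} {k l : Fin (2 * N)} (h : k ≠ l) :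
    majorana k * majorana l = -(majorana l * majorana k) := by
  wlog hkl : k < l generalizing k l
  · rw [this h.symm (lt_of_le_of_ne (not_lt.mp hkl) h.symm), neg_neg]
  have hs : site k ≤ site l := by
    simp only [site, Fin.mk_le_mk]; omega
  rcases hs.lt_or_eq with hs | hs
  · refine tensorOp_anticommute (site k) ?_ fun i hi => ?_
    · simp only [lt_self_iff_false, if_false, if_true, hs]
      split_ifs
      · exact pauliX_mul_pauliZ
      · exact pauliY_mul_pauliZ
    · rcases lt_or_gt_of_ne hi with h1 | h1
      · simp [h1, h1.trans hs]
      · simp [h1.not_gt, h1.ne']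
  · have hk : k.val % 2 = 0 ∧ l.val % 2 = 1 := by
      have := congrArg Fin.val hs
      simp only [site] at this
      omega
    refine tensorOp_anticommute (site k) ?_ fun i hi => ?_
    · simp [← hs, hk.1, hk.2, pauliX_mul_pauliY]
    · rcases lt_or_gt_of_ne hi with h1 | h1
      · simp [h1, ← hs]
      · simp [h1.not_gt, h1.ne', ← hs]

/-- An operator on the qubits of `S` commutes with a product operator that is trivial on `S`. -/
theorem extendOp_commute_tensorOp {N : ℕ} {S : Finset (Fin N)}
    (W : Matrix (Config S) (Config S) ℂ) {f : Fin N → Matrix (Fin 2) (Fin 2) ℂ}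
    (hf : ∀ i ∈ S, f i = 1) : extendOp S W * tensorOp f = tensorOp f * extendOp S W := by
  ext s u
  -- In each product a single intermediate configuration survives: one factor is diagonal outside
  -- `S`, the other diagonal on `S`.
  rw [Matrix.mul_apply, Matrix.mul_apply,
    Finset.sum_eq_single (fun i => if i ∈ S then u i else s i),
    Finset.sum_eq_single (fun i => if i ∈ S then s i else u i)]
  · simp only [extendOp, tensorOp, Matrix.of_apply]
    rw [if_pos (by intro i hi; simp [hi]), if_pos (by intro i hi; simp [hi]), mul_comm]
    congr 1
    · refine Finset.prod_congr rfl fun i _ => ?_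
      by_cases hi : i ∈ S <;> simp [hi, hf]
    · congr 1 <;> funext i <;> simp [i.2]
  · intro t _ ht
    by_cases h : ∀ i, i ∉ S → t i = u i
    · have : ∃ i ∈ S, s i ≠ t i := by
        by_contra! hc
        refine ht (funext fun i => ?_)
        by_cases hi : i ∈ S
        · simp [hi, hc i hi]
        · simp [hi, h i hi]
      obtain ⟨i, hi, hne⟩ := this
      have h0 : tensorOp f s t = 0 :=
        Finset.prod_eq_zero (Finset.mem_univ i) (by rw [hf i hi, Matrix.one_apply_ne hne])
      rw [h0, zero_mul]
    · simp [extendOp, h]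
  · exact fun h => absurd (Finset.mem_univ _) h
  · intro t _ ht
    by_cases h : ∀ i, i ∉ S → s i = t i
    · have : ∃ i ∈ S, t i ≠ u i := by
        by_contra! hc
        refine ht (funext fun i => ?_)
        by_cases hi : i ∈ S
        · simp [hi, hc i hi]
        · simp [hi, h i hi]
      obtain ⟨i, hi, hne⟩ := this
      have h0 : tensorOp f t u = 0 :=
        Finset.prod_eq_zero (Finset.mem_univ i) (by rw [hf i hi, Matrix.one_apply_ne hne])
      rw [h0, mul_zero]
    · simp [extendOp, h]
  · exact fun h => absurd (Finset.mem_univ _) h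

/-- A bilinear in two Majorana operators of an interval is trivial outside of the interval. -/
theorem majoranaFactor_mul_eq_one {N : ℕ} {A : Finset (Fin N)}
    (hA : (A : Set (Fin N)).OrdConnected) {d : Dimer N} (hd : d.Within A) {i : Fin N}
    (hi : i ∉ A) : majoranaFactor d.1 i * majoranaFactor d.2 i = 1 := by
  obtain ⟨h1, h2⟩ := hd
  have hn1 : i ≠ site d.1 := fun h => hi (h ▸ h1)
  have hn2 : i ≠ site d.2 := fun h => hi (h ▸ h2)
  rcases lt_or_gt_of_ne hn1 with h3 | h3 <;> rcases lt_or_gt_of_ne hn2 with h4 | h4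
  · simp [majoranaFactor, h3, h4, pauliZ_mul_self]
  · exact absurd (Finset.mem_coe.mp (hA.out h2 h1 ⟨h4.le, h3.le⟩)) hi
  · exact absurd (Finset.mem_coe.mp (hA.out h1 h2 ⟨h3.le, h4.le⟩)) hi
  · simp [majoranaFactor, h3.not_gt, h4.not_gt, hn1, hn2]

/-- A Majorana operator outside of an interval is constant on the interval. -/
theorem majoranaFactor_const_on {N : ℕ} {A : Finset (Fin N)}
    (hA : (A : Set (Fin N)).OrdConnected) {k : Fin (2 * N)} (hk : site k ∉ A) :
    (∀ i ∈ A, majoranaFactor k i = 1) ∨ (∀ i ∈ A, majoranaFactor k i = pauliZ) := by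
  by_cases h : ∃ i ∈ A, i < site k
  · right
    obtain ⟨i, hi, hlt⟩ := h
    intro j hj
    have : j < site k := by
      by_contra hc
      exact hk (Finset.mem_coe.mp (hA.out hi hj ⟨hlt.le, not_lt.mp hc⟩))
    simp [majoranaFactor, this]
  · left
    push Not at h
    intro j hj
    have h1 := h j hj
    have h2 : j ≠ site k := fun h => hk (h ▸ hj)
    simp [majoranaFactor, h1.not_gt, h2]

/-! ### Majorana operators on amplitudes indexed by lists -/

/-- The eigenvalue of `Z` on a basis state. -/
def zSign (s : Fin 2) : ℤ := if s = 0 then 1 else -1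

/-- The action of the Majorana operator of node `k` on amplitudes indexed by lists. -/
noncomputable def listMajorana : ℕ → (List (Fin 2) → ℂ) → List (Fin 2) → ℂ
  | _, _, [] => 0
  | 0, Φ, s :: t => Φ ((1 - s) :: t)
  | 1, Φ, s :: t => -Complex.I * zSign s * Φ ((1 - s) :: t)
  | k + 2, Φ, s :: t => zSign s * listMajorana k (fun r => Φ (s :: r)) t

theorem zSign_mul_self (s : Fin 2) : (zSign s : ℂ) * zSign s = 1 := by
  fin_cases s <;> simp [zSign]

theorem zSign_flip (s : Fin 2) : (zSign (1 - s) : ℂ) = -zSign s := by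
  fin_cases s <;> simp [zSign]

theorem listMajorana_sum {ι : Type*} (I : Finset ι) (a : ι → ℂ) (k : ℕ)
    (Φ : ι → List (Fin 2) → ℂ) (s : List (Fin 2)) :
    listMajorana k (fun r => ∑ i ∈ I, a i * Φ i r) s =
      ∑ i ∈ I, a i * listMajorana k (Φ i) s := by
  induction s generalizing k Φ with
  | nil => simp [listMajorana]
  | cons x t ih =>
    match k with
    | 0 => simp [listMajorana]
    | 1 =>
      simp only [listMajorana, Finset.mul_sum]
      exact Finset.sum_congr rfl fun i _ => by ring
    | k + 2 =>
      simp only [listMajorana, ih k (fun i r => Φ i (x :: r)), Finset.mul_sum]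
      exact Finset.sum_congr rfl fun i _ => by ring

/-- The eigenvalue of `Z ⊗ ⋯ ⊗ Z` on a basis state. -/
def listParity (s : List (Fin 2)) : ℤ := (s.map zSign).prod

theorem listParity_cons (x : Fin 2) (s : List (Fin 2)) :
    listParity (x :: s) = zSign x * listParity s := by simp [listParity]

theorem listParity_append (s t : List (Fin 2)) :
    listParity (s ++ t) = listParity s * listParity t := by simp [listParity]

theorem listMajorana_append_of_lt (k : ℕ) (Φ : List (Fin 2) → ℂ) (t r : List (Fin 2))
    (hk : k < 2 * t.length) :
    listMajorana k Φ (t ++ r) = listMajorana k (fun t => Φ (t ++ r)) t := by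
  induction t generalizing k Φ with
  | nil => simp at hk
  | cons x t ih =>
    match k with
    | 0 => simp [listMajorana]
    | 1 => simp [listMajorana]
    | k + 2 =>
      simp only [List.cons_append, listMajorana]
      rw [ih k (fun r => Φ (x :: r)) (by simp at hk; omega)]

/-- A node beyond the prefix `t` meets `t` only through its Jordan–Wigner string, which contributes
the parity of `t`. -/
theorem listMajorana_append_of_ge (j : ℕ) (Φ : List (Fin 2) → ℂ) (t r : List (Fin 2)) :
    listMajorana (2 * t.length + j) Φ (t ++ r) =
      listParity t * listMajorana j (fun r => Φ (t ++ r)) r := by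
  induction t generalizing Φ with
  | nil => simp [listParity]
  | cons x t ih =>
    have : 2 * (x :: t).length + j = (2 * t.length + j) + 2 := by simp; ring
    rw [this, List.cons_append, listMajorana, ih (fun r => Φ (x :: r)), listParity_cons]
    push_cast
    simp only [List.cons_append]
    ring

/-- This lets the gluing computations run by recursion on lists; each induction step peels one `Z`
off the string. -/
theorem majorana_mulVec_ofFn {N : ℕ} (k : Fin (2 * N)) (Φ : List (Fin 2) → ℂ)
    (s : Config (Fin N)) :
    (majorana k *ᵥ fun s : Config (Fin N) => Φ (List.ofFn s)) s =
      listMajorana k Φ (List.ofFn s) := by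
  induction N generalizing Φ with
  | zero => exact absurd k.2 (by omega)
  | succ N ih =>
    rw [majorana_mulVec]
    simp only [List.ofFn_succ]
    rcases hk : k.val with _ | _ | j
    · have h0 : site k = 0 := by ext; simp [site, hk]
      have h1 : majoranaSign k s = 1 := by simp [majoranaSign, h0, hk]
      simp [h0, h1, listMajorana]
    · have h0 : site k = 0 := by ext; simp [site, hk]
      have h1 : majoranaSign k s = -zSign (s 0) := by
        simp only [majoranaSign, h0, Fin.prod_univ_succ, hk]
        generalize s 0 = x
        fin_cases x <;> simp [zSign]
      simp [h0, h1, listMajorana]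
    · have hj : j < 2 * N := by omega
      have hj2 : (j + 1 + 1) % 2 = j % 2 := by omega
      have h0 : site k = (site (⟨j, hj⟩ : Fin (2 * N))).succ := by
        ext; simp only [site, hk, Fin.val_succ]; omega
      have h1 : majoranaSign k s =
          zSign (s 0) * majoranaSign (⟨j, hj⟩ : Fin (2 * N)) (fun i => s i.succ) := by
        simp only [majoranaSign, h0, Fin.prod_univ_succ, Fin.succ_pos, if_true,
          Fin.succ_lt_succ_iff, Fin.succ_inj, hj2, hk]
        congr 1
        generalize s 0 = x
        fin_cases x <;> simp [zSign]
      have h2 := ih ⟨j, hj⟩ (fun r => Φ (s 0 :: r)) (fun i => s i.succ)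
      rw [majorana_mulVec] at h2
      simp only [listMajorana, ← h2, h0, h1, Fin.succ_inj, hj2]
      rw [if_neg (Fin.succ_ne_zero _).symm]
      push_cast
      ring

/-! ### Pairings of nodes and their transport -/

/-- The Majorana operators of nodes `k` and `l` act proportionally on the amplitudes of `N`
qubits. -/
def MajoranaProportional (N : ℕ) (Φ : List (Fin 2) → ℂ) (k l : ℕ) : Prop :=
  ∃ r : ℂ, r ≠ 0 ∧ ∀ s : List (Fin 2), s.length = N →
    listMajorana k Φ s = r * listMajorana l Φ s

theorem MajoranaProportional.symm {N : ℕ} {Φ : List (Fin 2) → ℂ} {k l : ℕ}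
    (h : MajoranaProportional N Φ k l) : MajoranaProportional N Φ l k := by
  obtain ⟨r, hr, h⟩ := h
  exact ⟨r⁻¹, inv_ne_zero hr, fun s hs => by rw [h s hs, inv_mul_cancel_left₀ hr]⟩

/-- `σ` is an involution without fixed points of `{k | k < n}`. -/
def IsPairing (n : ℕ) (σ : ℕ → ℕ) : Prop :=
  ∀ k < n, σ k < n ∧ σ k ≠ k ∧ σ (σ k) = k

/-- The amplitudes `Φ` are those of an even or odd state of `N` qubits. -/
def HasParity (N : ℕ) (Φ : List (Fin 2) → ℂ) : Prop :=
  ∃ q : ℂ, q ≠ 0 ∧ ∀ s : List (Fin 2), s.length = N → (listParity s : ℂ) * Φ s = q * Φ s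

/-- A nonzero state of definite parity whose nodes are paired by `σ`. -/
structure IsPairedState (N : ℕ) (σ : ℕ → ℕ) (Φ : List (Fin 2) → ℂ) : Prop where
  ne_zero : ∃ s : List (Fin 2), s.length = N ∧ Φ s ≠ 0
  parity : HasParity N Φ
  proportional : ∀ k < 2 * N, MajoranaProportional N Φ k (σ k)

/-- `τ`, with left inverse `τ'`, is an injection of `{k | k < n}` into `{k | k < n'}`, and the
nodes `E` outside of its range are paired by `ρ`. -/
structure IsNodeTransport (n n' : ℕ) (τ τ' ρ : ℕ → ℕ) (E : ℕ → Prop) : Prop where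
  map : ∀ k < n, τ k < n' ∧ τ' (τ k) = k ∧ ¬ E (τ k)
  inv : ∀ k < n', ¬ E k → τ' k < n ∧ τ (τ' k) = k
  extra : ∀ k < n', E k → ρ k < n' ∧ E (ρ k) ∧ ρ k ≠ k ∧ ρ (ρ k) = k

theorem IsPairing.transport {n n' : ℕ} {σ : ℕ → ℕ} (hσ : IsPairing n σ) {τ τ' ρ : ℕ → ℕ}
    {E : ℕ → Prop} [DecidablePred E] (h : IsNodeTransport n n' τ τ' ρ E) :
    IsPairing n' fun k => if E k then ρ k else τ (σ (τ' k)) := by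
  intro k hk
  by_cases hE : E k
  · obtain ⟨h1, h2, h3, h4⟩ := h.extra k hk hE
    simp [hE, h1, h2, h3, h4]
  · obtain ⟨h1, h2⟩ := h.inv k hk hE
    obtain ⟨h3, h4, h5⟩ := hσ _ h1
    obtain ⟨h6, h7, h8⟩ := h.map _ h3
    simp only [hE, if_false, h6, h7, h8, h5, h2, true_and, and_true]
    intro h
    exact h4 (by rw [← h7, h])

/-- The common frame of the growth moves: old nodes are carried along by `τ` together with their
proportionality, and the new nodes `E` are paired among themselves by `ρ`. A pivot move has no new
nodes. -/
theorem IsPairedState.transport {N N' : ℕ} {σ : ℕ → ℕ} (hσ : IsPairing (2 * N) σ)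
    {τ τ' ρ : ℕ → ℕ} {E : ℕ → Prop} [DecidablePred E]
    (h : IsNodeTransport (2 * N) (2 * N') τ τ' ρ E) {Φ Φ' : List (Fin 2) → ℂ}
    (hΦ : IsPairedState N σ Φ) (h0 : ∃ s : List (Fin 2), s.length = N' ∧ Φ' s ≠ 0)
    (hpar : HasParity N' Φ')
    (hmap : ∀ k < 2 * N, ∀ l < 2 * N, MajoranaProportional N Φ k l →
      MajoranaProportional N' Φ' (τ k) (τ l))
    (hextra : ∀ k < 2 * N', E k → MajoranaProportional N' Φ' k (ρ k)) :
    IsPairedState N' (fun k => if E k then ρ k else τ (σ (τ' k))) Φ' := by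
  refine ⟨h0, hpar, fun k hk => ?_⟩
  by_cases hE : E k
  · simpa [hE] using hextra k hk hE
  · obtain ⟨h1, h2⟩ := h.inv k hk hE
    have h3 := hmap _ h1 _ (hσ _ h1).1 (hΦ.proportional _ h1)
    rw [h2] at h3
    simpa [hE] using h3

/-! ### Moving the pivot -/

/-- Amplitudes after the pivot has moved across the first edge. -/
theorem IsPairedState.rotate {n : ℕ} {σ : ℕ → ℕ} (hσ : IsPairing (2 * (n + 1)) σ)
    {Φ Φ' : List (Fin 2) → ℂ} (hΦ : IsPairedState (n + 1) σ Φ)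
    (hrot : ∀ t u, Φ' (t ++ [u]) = Φ (u :: t)) {τ τ' ρ : ℕ → ℕ} {E : ℕ → Prop} [DecidablePred E]
    (hτ : ∀ k, τ k = if k < 2 then 2 * n + k else k - 2) (hE : ∀ k, ¬ E k)
    (h : IsNodeTransport (2 * (n + 1)) (2 * (n + 1)) τ τ' ρ E) :
    IsPairedState (n + 1) (fun k => if E k then ρ k else τ (σ (τ' k))) Φ' := by
  have hlast : ∀ s : List (Fin 2), s.length = n + 1 → ∃ t u, t.length = n ∧ s = t ++ [u] := by
    intro s hs
    have hne : s ≠ [] := by rintro rfl; simp at hs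
    exact ⟨s.dropLast, s.getLast hne, by simp [hs], (List.dropLast_append_getLast hne).symm⟩
  obtain ⟨q, hq, hpar⟩ := hΦ.parity
  -- Every node acquires the same factor `Z` on the moved qubit, which therefore drops out of
  -- proportionality. For nodes that stay, the string loses this `Z`. For the two moved nodes, the
  -- new string over all other qubits is traded, by the total parity, for a `Z` on the moved qubit.
  have key : ∀ k < 2 * (n + 1), ∃ r : ℂ, r ≠ 0 ∧ ∀ (t : List (Fin 2)) (u : Fin 2),
      t.length = n →
        listMajorana (τ k) Φ' (t ++ [u]) = r * (zSign u * listMajorana k Φ (u :: t)) := by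
    intro k hk
    have hp : ∀ (t : List (Fin 2)) (u : Fin 2), t.length = n →
        listParity t * Φ ((1 - u) :: t) = -q * zSign u * Φ ((1 - u) :: t) := by
      intro t u ht
      have h1 := hpar ((1 - u) :: t) (by simp [ht])
      rw [listParity_cons] at h1
      push_cast at h1
      rw [zSign_flip] at h1
      linear_combination (-zSign u : ℂ) * h1 -
        listParity t * Φ ((1 - u) :: t) * zSign_mul_self u
    match k with
    | 0 =>
      refine ⟨-q, neg_ne_zero.mpr hq, fun t u ht => ?_⟩
      rw [hτ, if_pos (by norm_num), ← ht, listMajorana_append_of_ge]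
      simp only [listMajorana, hrot]
      linear_combination hp t u ht
    | 1 =>
      refine ⟨-q, neg_ne_zero.mpr hq, fun t u ht => ?_⟩
      rw [hτ, if_pos (by norm_num), ← ht, listMajorana_append_of_ge]
      simp only [listMajorana, hrot]
      linear_combination (-Complex.I * zSign u : ℂ) * hp t u ht
    | k + 2 =>
      refine ⟨1, one_ne_zero, fun t u ht => ?_⟩
      rw [hτ, if_neg (by omega), Nat.add_sub_cancel, listMajorana_append_of_lt _ _ _ _ (by omega)]
      simp only [listMajorana, hrot]
      linear_combination (-listMajorana k (fun r => Φ (u :: r)) t) * zSign_mul_self u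
  refine hΦ.transport hσ h ?_ ⟨q, hq, ?_⟩ ?_ fun k _ hk => absurd hk (hE k)
  · obtain ⟨s, hs, h0⟩ := hΦ.ne_zero
    match s, hs with
    | u :: t, hs => exact ⟨t ++ [u], by simpa using hs, by rwa [hrot]⟩
  · intro s hs
    obtain ⟨t, u, ht, rfl⟩ := hlast s hs
    have h1 := hpar (u :: t) (by simp [ht])
    rw [listParity_cons] at h1
    rw [listParity_append, hrot, ← h1]
    simp [listParity, mul_comm]
  · rintro k hk l hl ⟨r, hr, hkl⟩
    obtain ⟨a, ha, hk'⟩ := key k hk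
    obtain ⟨b, hb, hl'⟩ := key l hl
    refine ⟨a * r * b⁻¹, by simp [ha, hr, hb], fun s hs => ?_⟩
    obtain ⟨t, u, ht, rfl⟩ := hlast s hs
    rw [hk' t u ht, hl' t u ht, hkl (u :: t) (by simp [ht])]
    field_simp

/-! ### Gluing a pentagon -/

theorem sum_flip (f : Fin 2 → ℂ) : ∑ x, f x = ∑ x, f (1 - x) := by
  simp [Fin.sum_univ_two, add_comm]

/-- The contraction `C` respects scalars and intertwines `γ_k` with `γ_{τ k}` up to a nonzero
factor, so it carries a proportionality of two Majorana actions along. -/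
theorem MajoranaProportional.map {N N' : ℕ} {Φ Φ' : List (Fin 2) → ℂ} {τ : ℕ → ℕ}
    (C : (List (Fin 2) → ℂ) → List (Fin 2) → ℂ)
    (hC : ∀ (Ψ Ψ' : List (Fin 2) → ℂ) (r : ℂ), (∀ s : List (Fin 2), s.length = N →
      Ψ s = r * Ψ' s) → ∀ s : List (Fin 2), s.length = N' → C Ψ s = r * C Ψ' s)
    (hτ : ∀ k < 2 * N, ∃ r : ℂ, r ≠ 0 ∧ ∀ s : List (Fin 2), s.length = N' →
      C (listMajorana k Φ) s = r * listMajorana (τ k) Φ' s) {k l : ℕ} (hk : k < 2 * N)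
    (hl : l < 2 * N) (h : MajoranaProportional N Φ k l) :
    MajoranaProportional N' Φ' (τ k) (τ l) := by
  obtain ⟨r, hr, h⟩ := h
  obtain ⟨a, ha, hk⟩ := hτ k hk
  obtain ⟨b, hb, hl⟩ := hτ l hl
  refine ⟨a⁻¹ * r * b, by simp [ha, hr, hb], fun s hs => ?_⟩
  have h1 := hC _ _ r h s hs
  rw [hk s hs, hl s hs] at h1
  field_simp
  linear_combination h1

/-! ### Sign relations of the pentagon -/

theorem tile_eq_of_tileSign_eq {b : Fin 2} {s t : Fin 5 → Fin 2} {z : ℤ}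
    (h : tileSign b s = z * tileSign b t) : tile b s = z * tile b t := by
  simp only [tile, h]
  push_cast
  ring

/-- Each tile is even or odd. -/
theorem tile_parity (b : Fin 2) : ∃ r : ℂ, r ≠ 0 ∧ ∀ s₀ s₁ s₂ s₃ s₄ : Fin 2,
    tile b ![s₀, s₁, s₂, s₃, s₄] =
      r * (zSign s₀ * zSign s₁ * zSign s₂ * zSign s₃ * zSign s₄) *
        tile b ![s₀, s₁, s₂, s₃, s₄] := by
  have h : ∀ b : Fin 2, ∃ r : ℤˣ, ∀ s₀ s₁ s₂ s₃ s₄ : Fin 2, tileSign b ![s₀, s₁, s₂, s₃, s₄] =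
      (r * (zSign s₀ * zSign s₁ * zSign s₂ * zSign s₃ * zSign s₄) : ℤ) *
        tileSign b ![s₀, s₁, s₂, s₃, s₄] := by
    decide +kernel
  obtain ⟨r, h⟩ := h b
  refine ⟨((r : ℤ) : ℂ), by exact_mod_cast r.ne_zero, fun s₀ s₁ s₂ s₃ s₄ => ?_⟩
  have h1 := tile_eq_of_tileSign_eq (h s₀ s₁ s₂ s₃ s₄)
  push_cast at h1
  exact h1

/-- This lemma and the next four are the five dimers of the pentagon, in the order `(1, 6)`, `(0,
5)`, `(2, 7)`, `(3, 8)`, `(4, 9)`, with the common part of the strings cancelled. A bit flip on one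
leg is traded for a bit flip on another, with `Z` signs and a constant that depends only on `b`. -/
theorem tile_flip_0_3 (b : Fin 2) : ∃ r : ℂ, r ≠ 0 ∧ ∀ s₀ s₁ s₂ s₃ s₄ : Fin 2,
    tile b ![1 - s₀, s₁, s₂, s₃, s₄] =
      r * (zSign s₁ * zSign s₂) * tile b ![s₀, s₁, s₂, 1 - s₃, s₄] := by
  have h : ∀ b : Fin 2, ∃ r : ℤˣ, ∀ s₀ s₁ s₂ s₃ s₄ : Fin 2, tileSign b ![1 - s₀, s₁, s₂, s₃, s₄] =
      (r * (zSign s₁ * zSign s₂) : ℤ) * tileSign b ![s₀, s₁, s₂, 1 - s₃, s₄] := by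
    decide +kernel
  obtain ⟨r, h⟩ := h b
  refine ⟨((r : ℤ) : ℂ), by exact_mod_cast r.ne_zero, fun s₀ s₁ s₂ s₃ s₄ => ?_⟩
  have h1 := tile_eq_of_tileSign_eq (h s₀ s₁ s₂ s₃ s₄)
  push_cast at h1
  exact h1

theorem tile_flip_0_2 (b : Fin 2) : ∃ r : ℂ, r ≠ 0 ∧ ∀ s₀ s₁ s₂ s₃ s₄ : Fin 2,
    tile b ![1 - s₀, s₁, s₂, s₃, s₄] =
      r * (zSign s₀ * zSign s₁ * zSign s₂) * tile b ![s₀, s₁, 1 - s₂, s₃, s₄] := by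
  have h : ∀ b : Fin 2, ∃ r : ℤˣ, ∀ s₀ s₁ s₂ s₃ s₄ : Fin 2, tileSign b ![1 - s₀, s₁, s₂, s₃, s₄] =
      (r * (zSign s₀ * zSign s₁ * zSign s₂) : ℤ) * tileSign b ![s₀, s₁, 1 - s₂, s₃, s₄] := by
    decide +kernel
  obtain ⟨r, h⟩ := h b
  refine ⟨((r : ℤ) : ℂ), by exact_mod_cast r.ne_zero, fun s₀ s₁ s₂ s₃ s₄ => ?_⟩
  have h1 := tile_eq_of_tileSign_eq (h s₀ s₁ s₂ s₃ s₄)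
  push_cast at h1
  exact h1

theorem tile_flip_1_3 (b : Fin 2) : ∃ r : ℂ, r ≠ 0 ∧ ∀ s₀ s₁ s₂ s₃ s₄ : Fin 2,
    tile b ![s₀, 1 - s₁, s₂, s₃, s₄] =
      r * (zSign s₁ * zSign s₂ * zSign s₃) * tile b ![s₀, s₁, s₂, 1 - s₃, s₄] := by
  have h : ∀ b : Fin 2, ∃ r : ℤˣ, ∀ s₀ s₁ s₂ s₃ s₄ : Fin 2, tileSign b ![s₀, 1 - s₁, s₂, s₃, s₄] =
      (r * (zSign s₁ * zSign s₂ * zSign s₃) : ℤ) * tileSign b ![s₀, s₁, s₂, 1 - s₃, s₄] := by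
    decide +kernel
  obtain ⟨r, h⟩ := h b
  refine ⟨((r : ℤ) : ℂ), by exact_mod_cast r.ne_zero, fun s₀ s₁ s₂ s₃ s₄ => ?_⟩
  have h1 := tile_eq_of_tileSign_eq (h s₀ s₁ s₂ s₃ s₄)
  push_cast at h1
  exact h1

theorem tile_flip_1_4 (b : Fin 2) : ∃ r : ℂ, r ≠ 0 ∧ ∀ s₀ s₁ s₂ s₃ s₄ : Fin 2,
    tile b ![s₀, 1 - s₁, s₂, s₃, s₄] =
      r * (zSign s₂ * zSign s₃) * tile b ![s₀, s₁, s₂, s₃, 1 - s₄] := by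
  have h : ∀ b : Fin 2, ∃ r : ℤˣ, ∀ s₀ s₁ s₂ s₃ s₄ : Fin 2, tileSign b ![s₀, 1 - s₁, s₂, s₃, s₄] =
      (r * (zSign s₂ * zSign s₃) : ℤ) * tileSign b ![s₀, s₁, s₂, s₃, 1 - s₄] := by
    decide +kernel
  obtain ⟨r, h⟩ := h b
  refine ⟨((r : ℤ) : ℂ), by exact_mod_cast r.ne_zero, fun s₀ s₁ s₂ s₃ s₄ => ?_⟩
  have h1 := tile_eq_of_tileSign_eq (h s₀ s₁ s₂ s₃ s₄)
  push_cast at h1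
  exact h1

theorem tile_flip_2_4 (b : Fin 2) : ∃ r : ℂ, r ≠ 0 ∧ ∀ s₀ s₁ s₂ s₃ s₄ : Fin 2,
    tile b ![s₀, s₁, 1 - s₂, s₃, s₄] =
      r * (zSign s₂ * zSign s₃ * zSign s₄) * tile b ![s₀, s₁, s₂, s₃, 1 - s₄] := by
  have h : ∀ b : Fin 2, ∃ r : ℤˣ, ∀ s₀ s₁ s₂ s₃ s₄ : Fin 2, tileSign b ![s₀, s₁, 1 - s₂, s₃, s₄] =
      (r * (zSign s₂ * zSign s₃ * zSign s₄) : ℤ) * tileSign b ![s₀, s₁, s₂, s₃, 1 - s₄] := by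
    decide +kernel
  obtain ⟨r, h⟩ := h b
  refine ⟨((r : ℤ) : ℂ), by exact_mod_cast r.ne_zero, fun s₀ s₁ s₂ s₃ s₄ => ?_⟩
  have h1 := tile_eq_of_tileSign_eq (h s₀ s₁ s₂ s₃ s₄)
  push_cast at h1
  exact h1

/-! ### The two gluing maps -/

/-- The map on amplitudes that glues a pentagon along the first edge. -/
noncomputable def edgeGlue (b : Fin 2) (Φ : List (Fin 2) → ℂ) : List (Fin 2) → ℂ
  | s₀ :: s₁ :: s₂ :: s₃ :: s => ∑ x : Fin 2, tile b ![x, s₀, s₁, s₂, s₃] * Φ (x :: s)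
  | _ => 0

/-- The map on amplitudes that glues a pentagon along the first two edges. -/
noncomputable def cornerGlue (b : Fin 2) (Φ : List (Fin 2) → ℂ) : List (Fin 2) → ℂ
  | s₀ :: s₁ :: s₂ :: s =>
      ∑ x : Fin 2, ∑ y : Fin 2, tile b ![y, x, s₀, s₁, s₂] * Φ (x :: y :: s)
  | _ => 0

/-- A dimer ending on the glued edge enters the pentagon with the two nodes of the edge swapped,
because the orientations are opposite, and leaves at the opposite pentagon node: old nodes `0, 1`
become `4, 3`. The pentagon dimers that avoid the glued edge become the new pairs `0–5`, `1–6`,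
`2–7`. -/
theorem edgeGlue_isPairedState {n : ℕ} (b : Fin 2) {σ : ℕ → ℕ} (hσ : IsPairing (2 * (n + 1)) σ)
    {Φ : List (Fin 2) → ℂ} (hΦ : IsPairedState (n + 1) σ Φ) {τ τ' ρ : ℕ → ℕ} {E : ℕ → Prop}
    [DecidablePred E] (hτ : ∀ k, τ k = if k < 2 then 4 - k else k + 6)
    (hE : ∀ k, E k → k ≤ 2 ∧ ρ k = k + 5 ∨ (5 ≤ k ∧ k ≤ 7) ∧ ρ k = k - 5)
    (h : IsNodeTransport (2 * (n + 1)) (2 * (n + 4)) τ τ' ρ E) :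
    IsPairedState (n + 4) (fun k => if E k then ρ k else τ (σ (τ' k))) (edgeGlue b Φ) := by
  obtain ⟨rp, hrp, parity⟩ := tile_parity b
  obtain ⟨r03, hr03, flip03⟩ := tile_flip_0_3 b
  obtain ⟨r02, hr02, flip02⟩ := tile_flip_0_2 b
  obtain ⟨r13, hr13, flip13⟩ := tile_flip_1_3 b
  obtain ⟨r14, hr14, flip14⟩ := tile_flip_1_4 b
  obtain ⟨r24, hr24, flip24⟩ := tile_flip_2_4 b
  refine hΦ.transport hσ h ?_ ?_ ?_ ?_
  · obtain ⟨s, hs, h0⟩ := hΦ.ne_zero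
    match s, hs with
    | x :: t, hs =>
      -- The tile is supported on leg sum `b` modulo 2, so with these outer legs only the term `x`
      -- of the contraction survives.
      refine ⟨(b - x) :: 0 :: 0 :: 0 :: t, by simpa using hs, ?_⟩
      have h1 : ∀ b x : Fin 2, tileSign b ![x, b - x, 0, 0, 0] ≠ 0 ∧
          tileSign b ![1 - x, b - x, 0, 0, 0] = 0 := by decide +kernel
      obtain ⟨h1, h2⟩ := h1 b x
      have h3 : edgeGlue b Φ ((b - x) :: 0 :: 0 :: 0 :: t) =
          tile b ![x, b - x, 0, 0, 0] * Φ (x :: t) := by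
        rw [edgeGlue, Finset.sum_eq_single x]
        · intro y _ hy
          have : y = 1 - x := by omega
          simp [this, tile, h2]
        · simp
      rw [h3]
      exact mul_ne_zero (by simpa [tile] using h1) h0
  · obtain ⟨q, hq, hpar⟩ := hΦ.parity
    refine ⟨rp⁻¹ * q, mul_ne_zero (inv_ne_zero hrp) hq, fun s hs => ?_⟩
    match s, hs with
    | s₀ :: s₁ :: s₂ :: s₃ :: t, hs =>
      simp only [edgeGlue, listParity_cons, Finset.mul_sum]
      refine Finset.sum_congr rfl fun x _ => ?_
      have h1 := hpar (x :: t) (by simpa using hs)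
      have h2 := parity x s₀ s₁ s₂ s₃
      rw [listParity_cons] at h1
      push_cast at h1 ⊢
      field_simp
      linear_combination tile b ![x, s₀, s₁, s₂, s₃] * h1 -
        zSign x * listParity t * Φ (x :: t) * h2 -
        rp * (zSign s₀ * zSign s₁ * zSign s₂ * zSign s₃) * listParity t *
          tile b ![x, s₀, s₁, s₂, s₃] * Φ (x :: t) * zSign_mul_self x
  · intro k hk l hl
    refine MajoranaProportional.map (edgeGlue b) ?_ ?_ hk hl
    · intro Ψ Ψ' r hr s hs
      match s, hs with
      | s₀ :: s₁ :: s₂ :: s₃ :: t, hs =>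
        simp only [edgeGlue, Finset.mul_sum]
        refine Finset.sum_congr rfl fun x _ => ?_
        rw [hr (x :: t) (by simpa using hs)]
        ring
    · intro k hk
      match k with
      | 0 =>
        refine ⟨r03, hr03, fun s hs => ?_⟩
        match s, hs with
        | s₀ :: s₁ :: s₂ :: s₃ :: t, hs =>
          have h1 : τ 0 = 4 := by simp [hτ]
          rw [h1]
          simp only [listMajorana, edgeGlue, Finset.mul_sum]
          -- Reindexing the contracted leg moves the bit flip from `Φ` onto the tile, where a
          -- pentagon dimer carries it to an outer leg.
          refine (sum_flip _).trans (Finset.sum_congr rfl fun x _ => ?_)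
          simp only [sub_sub_cancel]
          linear_combination Φ (x :: t) * flip03 x s₀ s₁ s₂ s₃
      | 1 =>
        refine ⟨-r02, neg_ne_zero.mpr hr02, fun s hs => ?_⟩
        match s, hs with
        | s₀ :: s₁ :: s₂ :: s₃ :: t, hs =>
          have h1 : τ 1 = 3 := by simp [hτ]
          rw [h1]
          simp only [listMajorana, edgeGlue, Finset.mul_sum]
          refine (sum_flip _).trans (Finset.sum_congr rfl fun x _ => ?_)
          simp only [sub_sub_cancel, zSign_flip]
          linear_combination Complex.I * zSign x * Φ (x :: t) * flip02 x s₀ s₁ s₂ s₃ +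
            Complex.I * r02 * (zSign s₀ * zSign s₁) * tile b ![x, s₀, 1 - s₁, s₂, s₃] *
            Φ (x :: t) * zSign_mul_self x
      -- The string `Z` on the glued edge becomes `Z` on the four new edges, by the parity of the
      -- pentagon.
      | k + 2 =>
        refine ⟨rp, hrp, fun s hs => ?_⟩
        match s, hs with
        | s₀ :: s₁ :: s₂ :: s₃ :: t, hs =>
          have h1 : τ (k + 2) = k + 2 + 2 + 2 + 2 := by rw [hτ, if_neg (by omega)]
          simp only [h1, listMajorana, edgeGlue, listMajorana_sum, Finset.mul_sum]
          refine Finset.sum_congr rfl fun x _ => ?_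
          linear_combination zSign x * listMajorana k (fun r => Φ (x :: r)) t *
            parity x s₀ s₁ s₂ s₃ + rp * (zSign s₀ * zSign s₁ * zSign s₂ * zSign s₃) *
            tile b ![x, s₀, s₁, s₂, s₃] * listMajorana k (fun r => Φ (x :: r)) t *
            zSign_mul_self x
  · have h05 : MajoranaProportional (n + 4) (edgeGlue b Φ) 0 5 := by
      refine ⟨Complex.I * r13, mul_ne_zero Complex.I_ne_zero hr13, fun s hs => ?_⟩
      match s, hs with
      | s₀ :: s₁ :: s₂ :: s₃ :: t, hs =>
        simp only [listMajorana, edgeGlue, Finset.mul_sum]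
        refine Finset.sum_congr rfl fun x _ => ?_
        linear_combination Φ (x :: t) * flip13 x s₀ s₁ s₂ s₃ +
          r13 * (zSign s₀ * zSign s₁ * zSign s₂) * tile b ![x, s₀, s₁, 1 - s₂, s₃] *
          Φ (x :: t) * Complex.I_mul_I
    have h16 : MajoranaProportional (n + 4) (edgeGlue b Φ) 1 6 := by
      refine ⟨-Complex.I * r14, mul_ne_zero (neg_ne_zero.mpr Complex.I_ne_zero) hr14,
        fun s hs => ?_⟩
      match s, hs with
      | s₀ :: s₁ :: s₂ :: s₃ :: t, hs =>
        simp only [listMajorana, edgeGlue, Finset.mul_sum]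
        refine Finset.sum_congr rfl fun x _ => ?_
        linear_combination -Complex.I * zSign s₀ * Φ (x :: t) * flip14 x s₀ s₁ s₂ s₃
    have h27 : MajoranaProportional (n + 4) (edgeGlue b Φ) 2 7 := by
      refine ⟨Complex.I * r24, mul_ne_zero Complex.I_ne_zero hr24, fun s hs => ?_⟩
      match s, hs with
      | s₀ :: s₁ :: s₂ :: s₃ :: t, hs =>
        simp only [listMajorana, edgeGlue, Finset.mul_sum]
        refine Finset.sum_congr rfl fun x _ => ?_
        linear_combination zSign s₀ * Φ (x :: t) * flip24 x s₀ s₁ s₂ s₃ +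
          r24 * (zSign s₀ * zSign s₁ * zSign s₂ * zSign s₃) * tile b ![x, s₀, s₁, s₂, 1 - s₃] *
          Φ (x :: t) * Complex.I_mul_I
    intro k _ hk
    rcases hE k hk with ⟨h1, h2⟩ | ⟨h1, h2⟩ <;> rw [h2]
    · interval_cases k
      exacts [h05, h16, h27]
    · obtain ⟨h3, h4⟩ := h1
      interval_cases k
      exacts [h05.symm, h16.symm, h27.symm]

/-- The pentagon meets the two glued edges in reverse order, so their four nodes `k` leave the
pentagon at `4 - k`. The only pentagon dimer between outer legs is the new pair `0–5`. -/
theorem cornerGlue_isPairedState {n : ℕ} (b : Fin 2) {σ : ℕ → ℕ}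
    (hσ : IsPairing (2 * (n + 2)) σ) {Φ : List (Fin 2) → ℂ} (hΦ : IsPairedState (n + 2) σ Φ)
    {τ τ' ρ : ℕ → ℕ} {E : ℕ → Prop} [DecidablePred E]
    (hτ : ∀ k, τ k = if k < 4 then 4 - k else k + 2)
    (hE : ∀ k, E k → k = 0 ∧ ρ k = 5 ∨ k = 5 ∧ ρ k = 0)
    (h : IsNodeTransport (2 * (n + 2)) (2 * (n + 3)) τ τ' ρ E) :
    IsPairedState (n + 3) (fun k => if E k then ρ k else τ (σ (τ' k))) (cornerGlue b Φ) := by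
  obtain ⟨rp, hrp, parity⟩ := tile_parity b
  obtain ⟨r03, hr03, flip03⟩ := tile_flip_0_3 b
  obtain ⟨r02, hr02, flip02⟩ := tile_flip_0_2 b
  obtain ⟨r13, hr13, flip13⟩ := tile_flip_1_3 b
  obtain ⟨r14, hr14, flip14⟩ := tile_flip_1_4 b
  obtain ⟨r24, hr24, flip24⟩ := tile_flip_2_4 b
  refine hΦ.transport hσ h ?_ ?_ ?_ ?_
  · obtain ⟨s, hs, h0⟩ := hΦ.ne_zero
    match s, hs with
    | x :: y :: t, hs =>
      by_contra! hc
      -- Nonvanishing amounts to the tile being injective as a map from two legs to the other three.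
      -- Parity leaves the two terms `(x, y)` and `(1 - x, 1 - y)`; the outer configurations `s`,
      -- `s'` give two equations in these amplitudes, with determinant twice the nonzero product.
      have h1 : ∀ b x y : Fin 2, ∃ s s' : Fin 2 × Fin 2 × Fin 2,
          tileSign b ![1 - y, x, s.1, s.2.1, s.2.2] = 0 ∧
          tileSign b ![y, 1 - x, s.1, s.2.1, s.2.2] = 0 ∧
          tileSign b ![1 - y, x, s'.1, s'.2.1, s'.2.2] = 0 ∧
          tileSign b ![y, 1 - x, s'.1, s'.2.1, s'.2.2] = 0 ∧
          tileSign b ![y, x, s.1, s.2.1, s.2.2] *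
              tileSign b ![1 - y, 1 - x, s'.1, s'.2.1, s'.2.2] =
            -(tileSign b ![y, x, s'.1, s'.2.1, s'.2.2] *
              tileSign b ![1 - y, 1 - x, s.1, s.2.1, s.2.2]) ∧
          tileSign b ![y, x, s.1, s.2.1, s.2.2] *
              tileSign b ![1 - y, 1 - x, s'.1, s'.2.1, s'.2.2] ≠ 0 := by decide +kernel
      obtain ⟨⟨s₀, s₁, s₂⟩, ⟨s₀', s₁', s₂'⟩, h2, h3, h4, h5, h6, h7⟩ := h1 b x y
      have expand : ∀ f : Fin 2 → Fin 2 → ℂ, f (1 - x) y = 0 → f x (1 - y) = 0 →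
          ∑ u : Fin 2, ∑ v : Fin 2, f u v = f x y + f (1 - x) (1 - y) := by
        intro f hf1 hf2
        have h12 : ∀ g : Fin 2 → ℂ, ∀ u, ∑ v, g v = g u + g (1 - u) := by
          intro g u
          fin_cases u <;> simp [add_comm]
        rw [h12 _ x, h12 _ y, h12 _ y, hf1, hf2]
        ring
      have h8 := hc (s₀ :: s₁ :: s₂ :: t) (by simpa using hs)
      have h9 := hc (s₀' :: s₁' :: s₂' :: t) (by simpa using hs)
      simp only [cornerGlue] at h8 h9
      rw [expand _ (by simp [tile, h3]) (by simp [tile, h2])] at h8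
      rw [expand _ (by simp [tile, h5]) (by simp [tile, h4])] at h9
      simp only [tile] at h8 h9
      have h10 := congrArg (Int.cast : ℤ → ℂ) h6
      have h11 : ((tileSign b ![y, x, s₀, s₁, s₂] : ℤ) : ℂ) *
          (tileSign b ![1 - y, 1 - x, s₀', s₁', s₂'] : ℤ) ≠ 0 := by exact_mod_cast h7
      push_cast at h10
      refine mul_ne_zero h11 h0 ?_
      linear_combination 2 * (tileSign b ![1 - y, 1 - x, s₀', s₁', s₂'] : ℂ) * h8 -
        2 * (tileSign b ![1 - y, 1 - x, s₀, s₁, s₂] : ℂ) * h9 + (1 / 2) * Φ (x :: y :: t) * h10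
  · obtain ⟨q, hq, hpar⟩ := hΦ.parity
    refine ⟨rp⁻¹ * q, mul_ne_zero (inv_ne_zero hrp) hq, fun s hs => ?_⟩
    match s, hs with
    | s₀ :: s₁ :: s₂ :: t, hs =>
      simp only [cornerGlue, listParity_cons, Finset.mul_sum]
      refine Finset.sum_congr rfl fun x _ => Finset.sum_congr rfl fun y _ => ?_
      have h1 := hpar (x :: y :: t) (by simpa using hs)
      have h2 := parity y x s₀ s₁ s₂
      rw [listParity_cons, listParity_cons] at h1
      push_cast at h1 ⊢
      field_simp
      linear_combination tile b ![y, x, s₀, s₁, s₂] * h1 -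
        zSign x * zSign y * listParity t * Φ (x :: y :: t) * h2 -
        rp * (zSign s₀ * zSign s₁ * zSign s₂) * listParity t *
          tile b ![y, x, s₀, s₁, s₂] * Φ (x :: y :: t) *
          (zSign x * zSign x * zSign_mul_self y + zSign_mul_self x)
  · intro k hk l hl
    refine MajoranaProportional.map (cornerGlue b) ?_ ?_ hk hl
    · intro Ψ Ψ' r hr s hs
      match s, hs with
      | s₀ :: s₁ :: s₂ :: t, hs =>
        simp only [cornerGlue, Finset.mul_sum]
        refine Finset.sum_congr rfl fun x _ => Finset.sum_congr rfl fun y _ => ?_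
        rw [hr (x :: y :: t) (by simpa using hs)]
        ring
    · intro k hk
      match k with
      | 0 =>
        refine ⟨r14, hr14, fun s hs => ?_⟩
        match s, hs with
        | s₀ :: s₁ :: s₂ :: t, hs =>
          have h1 : τ 0 = 4 := by simp [hτ]
          rw [h1]
          simp only [listMajorana, cornerGlue, Finset.mul_sum]
          refine (sum_flip _).trans (Finset.sum_congr rfl fun x _ => Finset.sum_congr rfl fun y _ => ?_)
          simp only [sub_sub_cancel]
          linear_combination Φ (x :: y :: t) * flip14 y x s₀ s₁ s₂
      | 1 =>
        refine ⟨-r13, neg_ne_zero.mpr hr13, fun s hs => ?_⟩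
        match s, hs with
        | s₀ :: s₁ :: s₂ :: t, hs =>
          have h1 : τ 1 = 3 := by simp [hτ]
          rw [h1]
          simp only [listMajorana, cornerGlue, Finset.mul_sum]
          refine (sum_flip _).trans (Finset.sum_congr rfl fun x _ => Finset.sum_congr rfl fun y _ => ?_)
          simp only [sub_sub_cancel, zSign_flip]
          linear_combination Complex.I * zSign x * Φ (x :: y :: t) * flip13 y x s₀ s₁ s₂ +
            Complex.I * r13 * (zSign s₀ * zSign s₁) * tile b ![y, x, s₀, 1 - s₁, s₂] *
            Φ (x :: y :: t) * zSign_mul_self x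
      | 2 =>
        refine ⟨r03, hr03, fun s hs => ?_⟩
        match s, hs with
        | s₀ :: s₁ :: s₂ :: t, hs =>
          have h1 : τ 2 = 2 := by simp [hτ]
          rw [h1]
          simp only [listMajorana, cornerGlue, Finset.mul_sum]
          refine Finset.sum_congr rfl fun x _ => (sum_flip _).trans (Finset.sum_congr rfl fun y _ => ?_)
          simp only [sub_sub_cancel]
          linear_combination zSign x * Φ (x :: y :: t) * flip03 y x s₀ s₁ s₂ +
            r03 * zSign s₀ * tile b ![y, x, s₀, 1 - s₁, s₂] * Φ (x :: y :: t) *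
            zSign_mul_self x
      | 3 =>
        refine ⟨-r02, neg_ne_zero.mpr hr02, fun s hs => ?_⟩
        match s, hs with
        | s₀ :: s₁ :: s₂ :: t, hs =>
          have h1 : τ 3 = 1 := by simp [hτ]
          rw [h1]
          simp only [listMajorana, cornerGlue, Finset.mul_sum]
          refine Finset.sum_congr rfl fun x _ => (sum_flip _).trans (Finset.sum_congr rfl fun y _ => ?_)
          simp only [sub_sub_cancel, zSign_flip]
          linear_combination
            Complex.I * zSign x * zSign y * Φ (x :: y :: t) * flip02 y x s₀ s₁ s₂ +
            Complex.I * r02 * zSign s₀ * tile b ![y, x, 1 - s₀, s₁, s₂] * Φ (x :: y :: t) *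
            (zSign x * zSign x * zSign_mul_self y + zSign_mul_self x)
      | k + 4 =>
        refine ⟨rp, hrp, fun s hs => ?_⟩
        match s, hs with
        | s₀ :: s₁ :: s₂ :: t, hs =>
          have h1 : τ (k + 4) = k + 2 + 2 + 2 := by rw [hτ, if_neg (by omega)]
          have h3 : ∀ (x : Fin 2), listMajorana k (fun r => ∑ y : Fin 2,
              tile b ![y, x, s₀, s₁, s₂] * Φ (x :: y :: r)) t = ∑ y : Fin 2,
              tile b ![y, x, s₀, s₁, s₂] * listMajorana k (fun r => Φ (x :: y :: r)) t :=
            fun x => listMajorana_sum _ _ _ _ _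
          have h4 := listMajorana_sum Finset.univ (fun _ => 1) k (fun (x : Fin 2) r =>
            ∑ y : Fin 2, tile b ![y, x, s₀, s₁, s₂] * Φ (x :: y :: r)) t
          simp only [one_mul] at h4
          simp only [h1, listMajorana, cornerGlue, h3, h4, Finset.mul_sum]
          refine Finset.sum_congr rfl fun x _ => Finset.sum_congr rfl fun y _ => ?_
          linear_combination zSign x * zSign y * listMajorana k (fun r => Φ (x :: y :: r)) t *
            parity y x s₀ s₁ s₂ + rp * (zSign s₀ * zSign s₁ * zSign s₂) *
            tile b ![y, x, s₀, s₁, s₂] * listMajorana k (fun r => Φ (x :: y :: r)) t *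
            (zSign x * zSign x * zSign_mul_self y + zSign_mul_self x)
  · have h05 : MajoranaProportional (n + 3) (cornerGlue b Φ) 0 5 := by
      refine ⟨Complex.I * r24, mul_ne_zero Complex.I_ne_zero hr24, fun s hs => ?_⟩
      match s, hs with
      | s₀ :: s₁ :: s₂ :: t, hs =>
        simp only [listMajorana, cornerGlue, Finset.mul_sum]
        refine Finset.sum_congr rfl fun x _ => Finset.sum_congr rfl fun y _ => ?_
        linear_combination Φ (x :: y :: t) * flip24 y x s₀ s₁ s₂ +
          r24 * (zSign s₀ * zSign s₁ * zSign s₂) * tile b ![y, x, s₀, s₁, 1 - s₂] *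
          Φ (x :: y :: t) * Complex.I_mul_I
    intro k _ hk
    rcases hE k hk with ⟨h1, h2⟩ | ⟨h1, h2⟩ <;> rw [h2, h1]
    exacts [h05, h05.symm]

/-! ### The code states are paired states -/

theorem Patch.amp_seed (b : Config (Fin 1)) (s₀ s₁ s₂ s₃ s₄ : Fin 2) :
    Patch.seed.amp b [s₀, s₁, s₂, s₃, s₄] = tile (b 0) ![s₀, s₁, s₂, s₃, s₄] := rfl

theorem Patch.amp_seed_isPairedState (b : Config (Fin 1)) :
    IsPairedState 5 (fun k => if k < 5 then k + 5 else k - 5) (Patch.seed.amp b) := by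
  obtain ⟨rp, hrp, parity⟩ := tile_parity (b 0)
  obtain ⟨r03, hr03, flip03⟩ := tile_flip_0_3 (b 0)
  obtain ⟨r02, hr02, flip02⟩ := tile_flip_0_2 (b 0)
  obtain ⟨r13, hr13, flip13⟩ := tile_flip_1_3 (b 0)
  obtain ⟨r14, hr14, flip14⟩ := tile_flip_1_4 (b 0)
  obtain ⟨r24, hr24, flip24⟩ := tile_flip_2_4 (b 0)
  refine ⟨⟨[b 0, 0, 0, 0, 0], rfl, ?_⟩, ⟨rp⁻¹, inv_ne_zero hrp, fun s hs => ?_⟩, ?_⟩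
  · have h : ∀ x : Fin 2, tileSign x ![x, 0, 0, 0, 0] ≠ 0 := by decide +kernel
    simpa [Patch.amp_seed, tile] using h (b 0)
  · match s, hs with
    | [s₀, s₁, s₂, s₃, s₄], _ =>
      have h := parity s₀ s₁ s₂ s₃ s₄
      simp only [listParity, List.map, List.prod_cons, List.prod_nil, Patch.amp_seed]
      push_cast
      field_simp
      linear_combination -h
  · have h05 : MajoranaProportional 5 (Patch.seed.amp b) 0 5 := by
      refine ⟨Complex.I * r02, mul_ne_zero Complex.I_ne_zero hr02, fun s hs => ?_⟩
      match s, hs with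
      | [s₀, s₁, s₂, s₃, s₄], _ =>
        simp only [listMajorana, Patch.amp_seed]
        linear_combination flip02 s₀ s₁ s₂ s₃ s₄ + r02 * (zSign s₀ * zSign s₁ * zSign s₂) *
          tile (b 0) ![s₀, s₁, 1 - s₂, s₃, s₄] * Complex.I_mul_I
    have h16 : MajoranaProportional 5 (Patch.seed.amp b) 1 6 := by
      refine ⟨-Complex.I * r03, mul_ne_zero (neg_ne_zero.mpr Complex.I_ne_zero) hr03,
        fun s hs => ?_⟩
      match s, hs with
      | [s₀, s₁, s₂, s₃, s₄], _ =>
        simp only [listMajorana, Patch.amp_seed]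
        linear_combination -Complex.I * zSign s₀ * flip03 s₀ s₁ s₂ s₃ s₄
    have h27 : MajoranaProportional 5 (Patch.seed.amp b) 2 7 := by
      refine ⟨Complex.I * r13, mul_ne_zero Complex.I_ne_zero hr13, fun s hs => ?_⟩
      match s, hs with
      | [s₀, s₁, s₂, s₃, s₄], _ =>
        simp only [listMajorana, Patch.amp_seed]
        linear_combination zSign s₀ * flip13 s₀ s₁ s₂ s₃ s₄ +
          r13 * (zSign s₀ * zSign s₁ * zSign s₂ * zSign s₃) *
          tile (b 0) ![s₀, s₁, s₂, 1 - s₃, s₄] * Complex.I_mul_I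
    have h38 : MajoranaProportional 5 (Patch.seed.amp b) 3 8 := by
      refine ⟨-Complex.I * r14, mul_ne_zero (neg_ne_zero.mpr Complex.I_ne_zero) hr14,
        fun s hs => ?_⟩
      match s, hs with
      | [s₀, s₁, s₂, s₃, s₄], _ =>
        simp only [listMajorana, Patch.amp_seed]
        linear_combination -Complex.I * zSign s₀ * zSign s₁ * flip14 s₀ s₁ s₂ s₃ s₄
    have h49 : MajoranaProportional 5 (Patch.seed.amp b) 4 9 := by
      refine ⟨Complex.I * r24, mul_ne_zero Complex.I_ne_zero hr24, fun s hs => ?_⟩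
      match s, hs with
      | [s₀, s₁, s₂, s₃, s₄], _ =>
        simp only [listMajorana, Patch.amp_seed]
        linear_combination zSign s₀ * zSign s₁ * flip24 s₀ s₁ s₂ s₃ s₄ +
          r24 * (zSign s₀ * zSign s₁ * zSign s₂ * zSign s₃ * zSign s₄) *
          tile (b 0) ![s₀, s₁, s₂, s₃, 1 - s₄] * Complex.I_mul_I
    intro k hk
    interval_cases k
    exacts [h05, h16, h27, h38, h49, h05.symm, h16.symm, h27.symm, h38.symm, h49.symm]

theorem Patch.amp_movePivot {m d : ℕ} {c : List ℕ} (P : Patch m (d :: c)) (b : Config (Fin m))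
    (t : List (Fin 2)) (u : Fin 2) : P.movePivot.amp b (t ++ [u]) = P.amp b (u :: t) := by
  cases t with
  | nil => rfl
  | cons x t =>
    have h : P.movePivot.amp b (x :: (t ++ [u])) =
      P.amp b ((x :: (t ++ [u])).getLast (by simp) :: (x :: (t ++ [u])).dropLast) := rfl
    rw [List.cons_append, h]
    simp [List.dropLast_cons_of_ne_nil]

theorem Patch.amp_glueEdge {m d e : ℕ} {c : List ℕ} (P : Patch m (d :: e :: c)) (hd : d ≤ 2)
    (he : e ≤ 2) (b : Config (Fin (m + 1))) :
    (P.glueEdge hd he).amp b = edgeGlue (b 0) (P.amp (Fin.tail b)) := by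
  funext s
  match s with
  | [] | [_] | [_, _] | [_, _, _] => rfl
  | _ :: _ :: _ :: _ :: _ => rfl

theorem Patch.amp_glueCorner {m d e : ℕ} {c : List ℕ} (P : Patch m (d :: 3 :: e :: c))
    (hd : d ≤ 2) (he : e ≤ 2) (b : Config (Fin (m + 1))) :
    (P.glueCorner hd he).amp b = cornerGlue (b 0) (P.amp (Fin.tail b)) := by
  funext s
  match s with
  | [] | [_] | [_, _] => rfl
  | _ :: _ :: _ :: _ => rfl

/-- All code states of a patch are paired states, with a common pairing of the nodes. -/
theorem Patch.exists_pairing {m : ℕ} {c : List ℕ} (P : Patch m c) :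
    ∃ σ, IsPairing (2 * c.length) σ ∧ ∀ b, IsPairedState c.length σ (P.amp b) := by
  induction P with
  | seed =>
    refine ⟨_, fun k hk => ?_, Patch.amp_seed_isPairedState⟩
    simp only [List.length_cons, List.length_nil] at hk
    interval_cases k <;> simp
  | @movePivot m d c P ih =>
    obtain ⟨σ, hσ, h⟩ := ih
    have hT : IsNodeTransport (2 * (c.length + 1)) (2 * (c.length + 1))
        (fun k => if k < 2 then 2 * c.length + k else k - 2)
        (fun k => if 2 * c.length ≤ k then k - 2 * c.length else k + 2) id (fun _ => False) := by
      constructor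
      · intro k hk
        refine ⟨?_, ?_, not_false⟩ <;> split_ifs <;> omega
      · intro k hk _
        constructor <;> split_ifs <;> omega
      · exact fun _ _ h => h.elim
    have hlen : (c ++ [d]).length = c.length + 1 := by simp
    rw [hlen]
    exact ⟨_, hσ.transport hT, fun b => (h b).rotate hσ (Patch.amp_movePivot P b)
      (fun _ => rfl) (fun _ => not_false) hT⟩
  | @glueEdge m d e c P hd he ih =>
    obtain ⟨σ, hσ, h⟩ := ih
    -- The new nodes are `0, 1, 2, 5, 6, 7`; nodes `3, 4` are the ends of the strands from the glued
    -- edge.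
    have hT : IsNodeTransport (2 * (c.length + 1 + 1)) (2 * (c.length + 1 + 4))
        (fun k => if k < 2 then 4 - k else k + 6) (fun k => if k < 5 then 4 - k else k - 6)
        (fun k => if k < 5 then k + 5 else k - 5) (fun k => k < 3 ∨ 4 < k ∧ k < 8) := by
      constructor
      · intro k hk
        refine ⟨?_, ?_, ?_⟩ <;> split_ifs <;> omega
      · intro k hk hE
        constructor <;> split_ifs <;> omega
      · intro k hk hE
        refine ⟨?_, ?_, ?_, ?_⟩ <;> split_ifs <;> omega
    refine ⟨_, hσ.transport hT, fun b => ?_⟩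
    rw [Patch.amp_glueEdge]
    exact edgeGlue_isPairedState (b 0) hσ (h (Fin.tail b)) (fun _ => rfl)
      (fun k hE => by split_ifs <;> omega) hT
  | @glueCorner m d e c P hd he ih =>
    obtain ⟨σ, hσ, h⟩ := ih
    -- Only `0` and `5` are new; nodes `1, …, 4` are the ends of the strands from the two glued
    -- edges.
    have hT : IsNodeTransport (2 * (c.length + 1 + 2)) (2 * (c.length + 1 + 3))
        (fun k => if k < 4 then 4 - k else k + 2) (fun k => if k < 5 then 4 - k else k - 2)
        (fun k => if k < 5 then 5 else 0) (fun k => k = 0 ∨ k = 5) := by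
      constructor
      · intro k hk
        rcases lt_or_ge k 4 with h4 | h4
        · interval_cases k <;> simp <;> omega
        · have h5 : ¬ k + 2 < 5 := by omega
          simp only [h4.not_gt, h5, if_false]
          omega
      · intro k hk hE
        constructor <;> split_ifs <;> omega
      · intro k hk hE
        refine ⟨?_, ?_, ?_, ?_⟩ <;> split_ifs <;> omega
    refine ⟨_, hσ.transport hT, fun b => ?_⟩
    rw [Patch.amp_glueCorner]
    exact cornerGlue_isPairedState (b 0) hσ (h (Fin.tail b)) (fun _ => rfl)
      (fun k hE => by split_ifs <;> omega) hT

/-! ### From paired states to dimer states -/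

/-- The dimers of a pairing of the nodes. -/
def pairingDimers (N : ℕ) (σ : ℕ → ℕ) : Finset (Dimer N) :=
  Finset.univ.filter fun d => d.1 < d.2 ∧ σ d.1 = d.2

theorem mem_pairingDimers {N : ℕ} {σ : ℕ → ℕ} {d : Dimer N} :
    d ∈ pairingDimers N σ ↔ d.1.val < d.2.val ∧ σ d.1 = d.2 := by
  simp [pairingDimers]

theorem IsPairing.isDimerPairing {N : ℕ} {σ : ℕ → ℕ} (h : IsPairing (2 * N) σ) :
    IsDimerPairing (pairingDimers N σ) := by
  refine ⟨fun d hd => (mem_pairingDimers.mp hd).1, fun k => ?_⟩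
  obtain ⟨h1, h2, h3⟩ := h k k.2
  rcases lt_or_gt_of_ne h2 with h4 | h4
  · refine ⟨(⟨σ k, h1⟩, k), ⟨mem_pairingDimers.mpr ⟨h4, h3⟩, Or.inr rfl⟩, ?_⟩
    rintro ⟨x, y⟩ ⟨hd, h5⟩
    obtain ⟨h6, h7⟩ := mem_pairingDimers.mp hd
    have h8 := (h x x.2).2.2
    dsimp only at h5 h6 h7
    rcases h5 with rfl | rfl
    · omega
    · exact Prod.ext (Fin.ext (by rw [← h8, h7])) rfl
  · refine ⟨(k, ⟨σ k, h1⟩), ⟨mem_pairingDimers.mpr ⟨h4, rfl⟩, Or.inl rfl⟩, ?_⟩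
    rintro ⟨x, y⟩ ⟨hd, h5⟩
    obtain ⟨h6, h7⟩ := mem_pairingDimers.mp hd
    have h8 := (h x x.2).2.2
    dsimp only at h5 h6 h7
    rcases h5 with rfl | rfl
    · exact Prod.ext rfl (Fin.ext h7.symm)
    · rw [← h7, h8] at h4
      omega

/-- If two Majorana operators act proportionally on a state, their bilinear has an eigenvalue
`± i`. -/
theorem exists_parity_of_proportional {N : ℕ} {ψ : QState N} (hψ : ψ ≠ 0) {k l : Fin (2 * N)}
    (hkl : k ≠ l) {r : ℂ} (h : majorana k *ᵥ ψ = r • (majorana l *ᵥ ψ)) :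
    ∃ p : ℤˣ, (majorana k + (Complex.I * ((p : ℤ) : ℂ)) • majorana l) *ᵥ ψ = 0 := by
  have h1 : ψ = r • ((majorana k * majorana l) *ᵥ ψ) := by
    rw [← Matrix.mulVec_mulVec, ← Matrix.mulVec_smul, ← h, Matrix.mulVec_mulVec,
      majorana_mul_self, Matrix.one_mulVec]
  have h2 : (majorana l * majorana k) *ᵥ ψ = r • ψ := by
    rw [← Matrix.mulVec_mulVec, h, Matrix.mulVec_smul, Matrix.mulVec_mulVec,
      majorana_mul_self, Matrix.one_mulVec]
  rw [majorana_anticommute hkl, Matrix.neg_mulVec, h2] at h1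
  -- Anticommutation forces `r² = -1`, so `r = ± i`.
  have h3 : (r * r + 1) • ψ = 0 := by
    rw [add_smul, one_smul, mul_smul]
    nth_rewrite 2 [h1]
    rw [smul_neg, add_neg_cancel]
  have h4 : (r - Complex.I) * (r + Complex.I) = 0 := by
    have := (smul_eq_zero.mp h3).resolve_right hψ
    linear_combination this - Complex.I_mul_I
  rcases mul_eq_zero.mp h4 with h5 | h5
  · refine ⟨-1, ?_⟩
    rw [Matrix.add_mulVec, h, Matrix.smul_mulVec, ← add_smul]
    convert zero_smul ℂ _
    push_cast
    linear_combination h5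
  · refine ⟨1, ?_⟩
    rw [Matrix.add_mulVec, h, Matrix.smul_mulVec, ← add_smul]
    convert zero_smul ℂ _
    push_cast
    linear_combination h5

theorem IsPairedState.exists_isDimerState {N : ℕ} {σ : ℕ → ℕ} (hσ : IsPairing (2 * N) σ)
    {Φ : List (Fin 2) → ℂ} (h : IsPairedState N σ Φ) :
    ∃ p : Dimer N → ℤˣ, IsDimerState (fun s => Φ (List.ofFn s)) (pairingDimers N σ) p := by
  have h0 : (fun s : Config (Fin N) => Φ (List.ofFn s)) ≠ 0 := by
    obtain ⟨s, rfl, hs⟩ := h.ne_zero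
    intro hc
    exact hs (by simpa using congrFun hc s.get)
  have key : ∀ d : Dimer N, ∃ p : ℤˣ, d ∈ pairingDimers N σ →
      (majorana d.1 + (Complex.I * ((p : ℤ) : ℂ)) • majorana d.2) *ᵥ
        (fun s : Config (Fin N) => Φ (List.ofFn s)) = 0 := by
    intro d
    by_cases hd : d ∈ pairingDimers N σ
    · have hd' := hd
      rw [mem_pairingDimers] at hd'
      obtain ⟨r, _, hr⟩ := h.proportional d.1 d.1.2
      obtain ⟨p, hp⟩ := exists_parity_of_proportional h0 (Fin.ne_of_val_ne hd'.1.ne) (r := r) (by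
        funext s
        rw [majorana_mulVec_ofFn, Pi.smul_apply, majorana_mulVec_ofFn, smul_eq_mul, ← hd'.2]
        exact hr _ (by simp))
      exact ⟨p, fun _ => hp⟩
    · exact ⟨1, fun h => absurd h hd⟩
  choose p hp using key
  exact ⟨p, h0, hσ.isDimerPairing, hp⟩

/-- Used to remove a `Z` on every qubit of `A`: applying `Z` on all qubits only rescales a code
state. -/
theorem HasParity.tensorOp_mulVec {N : ℕ} {Φ : List (Fin 2) → ℂ} (h : HasParity N Φ) :
    ∃ q : ℂ, q ≠ 0 ∧ tensorOp (fun _ => pauliZ) *ᵥ (fun s : Config (Fin N) => Φ (List.ofFn s)) =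
      q • fun s : Config (Fin N) => Φ (List.ofFn s) := by
  obtain ⟨q, hq, h⟩ := h
  refine ⟨q, hq, funext fun s => ?_⟩
  rw [Pi.smul_apply, smul_eq_mul, ← h _ (by simp), Matrix.mulVec, dotProduct,
    Finset.sum_eq_single s]
  · congr 1
    simp only [tensorOp, Matrix.of_apply, listParity, List.map_ofFn, List.prod_ofFn, Int.cast_prod]
    refine Finset.prod_congr rfl fun i _ => ?_
    simp only [Function.comp]
    generalize s i = x
    fin_cases x <;> simp [pauliZ, zSign]
  · intro t _ ht
    obtain ⟨i, hi⟩ := Function.ne_iff.mp ht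
    have h0 : tensorOp (fun _ => pauliZ) s t = 0 := by
      refine Finset.prod_eq_zero (Finset.mem_univ i) ?_
      revert hi
      generalize s i = x
      generalize t i = y
      fin_cases x <;> fin_cases y <;> simp [pauliZ]
    rw [h0, zero_mul]
  · exact fun h => absurd (Finset.mem_univ _) h

/-! ### Dimer operators -/

/-- The product of the two Majorana operators of a dimer. -/
noncomputable def dimerOp {N : ℕ} (d : Dimer N) : Matrix (Config (Fin N)) (Config (Fin N)) ℂ :=
  majorana d.1 * majorana d.2

theorem dimerOp_mul_majorana {N : ℕ} {d : Dimer N} {k : Fin (2 * N)} (h1 : d.1 ≠ k)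
    (h2 : d.2 ≠ k) : dimerOp d * majorana k = majorana k * dimerOp d := by
  rw [dimerOp, mul_assoc, majorana_anticommute h2, mul_neg, ← mul_assoc,
    majorana_anticommute h1, neg_mul, neg_neg, mul_assoc]

theorem dimerOp_mul_majorana_end {N : ℕ} {d : Dimer N} (hd : d.1 ≠ d.2) {k : Fin (2 * N)}
    (h : d.1 = k ∨ d.2 = k) : dimerOp d * majorana k = -(majorana k * dimerOp d) := by
  rcases h with rfl | rfl
  · rw [dimerOp, mul_assoc, majorana_anticommute hd.symm, mul_neg]
  · nth_rewrite 2 [dimerOp]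
    rw [majorana_anticommute hd, mul_neg, neg_neg, ← mul_assoc, majorana_mul_self, one_mul,
      dimerOp, mul_assoc, majorana_mul_self, mul_one]

theorem IsDimerState.dimerOp_mulVec {N : ℕ} {ψ : QState N} {M : Finset (Dimer N)}
    {p : Dimer N → ℤˣ} (h : IsDimerState ψ M p) {d : Dimer N} (hd : d ∈ M) :
    dimerOp d *ᵥ ψ = (Complex.I * ((p d : ℤ) : ℂ)) • ψ := by
  have h1 := h.2.2 d hd
  rw [Matrix.add_mulVec, Matrix.smul_mulVec] at h1
  rw [dimerOp, majorana_anticommute (h.2.1.1 d hd).ne, Matrix.neg_mulVec,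
    ← Matrix.mulVec_mulVec, eq_neg_of_add_eq_zero_left h1, Matrix.mulVec_neg, neg_neg,
    Matrix.mulVec_smul, Matrix.mulVec_mulVec, majorana_mul_self, Matrix.one_mulVec]

theorem IsDimerPairing.eq_of_shared_node {N : ℕ} {M : Finset (Dimer N)} (hM : IsDimerPairing M)
    {d e : Dimer N} (hd : d ∈ M) (he : e ∈ M) {k : Fin (2 * N)} (h1 : d.1 = k ∨ d.2 = k)
    (h2 : e.1 = k ∨ e.2 = k) : d = e :=
  (hM.2 k).unique ⟨hd, h1⟩ ⟨he, h2⟩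

theorem IsDimerPairing.card {N : ℕ} {M : Finset (Dimer N)} (hM : IsDimerPairing M) :
    M.card = N := by
  have h1 : (Finset.univ : Finset (Fin (2 * N))) = M.biUnion fun d => {d.1, d.2} := by
    ext k
    obtain ⟨d, ⟨hd, hk⟩, _⟩ := hM.2 k
    simp only [Finset.mem_univ, Finset.mem_biUnion, Finset.mem_insert, Finset.mem_singleton,
      true_iff]
    exact ⟨d, hd, hk.imp Eq.symm Eq.symm⟩
  have h2 := congrArg Finset.card h1
  rw [Finset.card_biUnion, Finset.sum_congr rfl fun d hd => Finset.card_pair (hM.1 d hd).ne] at h2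
  · simp at h2
    omega
  · intro d hd e he hne
    refine Finset.disjoint_left.mpr ?_
    intro k h3 h4
    simp only [Finset.mem_insert, Finset.mem_singleton] at h3 h4
    exact hne (hM.eq_of_shared_node hd he (h3.imp Eq.symm Eq.symm) (h4.imp Eq.symm Eq.symm))

/-! ### Rigidity of dimer states -/

/-- The joint eigenspace of the dimer operators of `D`. -/
noncomputable def dimerEigenspace {N : ℕ} (D : Finset (Dimer N)) (μ : Dimer N → ℂ) :
    Submodule ℂ (QState N) where
  carrier := {ψ | ∀ d ∈ D, dimerOp d *ᵥ ψ = μ d • ψ}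
  add_mem' := fun {x y} hx hy d hd => by rw [Matrix.mulVec_add, hx d hd, hy d hd, smul_add]
  zero_mem' := fun d _ => by rw [Matrix.mulVec_zero, smul_zero]
  smul_mem' := fun r x hx d hd => by rw [Matrix.mulVec_smul, hx d hd, smul_comm]

/-- Each further dimer at least halves the dimension. The Majorana operator at one end of `d`
commutes with the other dimer operators and anticommutes with that of `d`. It thus maps the `μ d`
eigenspace injectively into the `-μ d` eigenspace, and since `μ d ≠ 0` the two are independent
inside the space for `D`. -/
theorem finrank_dimerEigenspace {N : ℕ} {M : Finset (Dimer N)} (hM : IsDimerPairing M)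
    {μ : Dimer N → ℂ} (hμ : ∀ d, μ d ≠ 0) (D : Finset (Dimer N)) (hD : D ⊆ M) :
    2 ^ D.card * Module.finrank ℂ (dimerEigenspace D μ) ≤ 2 ^ N := by
  induction D using Finset.induction_on with
  | empty =>
    refine (Nat.mul_le_mul_left _ (Submodule.finrank_le _)).trans ?_
    simp
  | insert d D hdD ih =>
    have hdM : d ∈ M := hD (Finset.mem_insert_self d D)
    have ih := ih ((Finset.subset_insert d D).trans hD)
    set E := dimerEigenspace (insert d D) μ with hE
    set T : QState N →ₗ[ℂ] QState N := (majorana d.1).mulVecLin with hT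
    have hinj : Function.Injective T := by
      refine Function.LeftInverse.injective (g := T) fun x => ?_
      simp [hT, Matrix.mulVec_mulVec, majorana_mul_self]
    have h1 : Module.finrank ℂ (E.map T) = Module.finrank ℂ E :=
      (Submodule.equivMapOfInjective T hinj E).finrank_eq.symm
    have h2 : E ⊔ E.map T ≤ dimerEigenspace D μ := by
      refine sup_le (fun x hx e he => hx e (Finset.mem_insert_of_mem he)) ?_
      rintro _ ⟨x, hx, rfl⟩ e he
      have heM : e ∈ M := hD (Finset.mem_insert_of_mem he)
      have hne : d ≠ e := fun h => hdD (h ▸ he)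
      rw [hT, Matrix.mulVecLin_apply, Matrix.mulVec_mulVec, dimerOp_mul_majorana,
        ← Matrix.mulVec_mulVec, hx e (Finset.mem_insert_of_mem he), Matrix.mulVec_smul]
      · exact fun h => hne (hM.eq_of_shared_node hdM heM (Or.inl rfl) (Or.inl h))
      · exact fun h => hne (hM.eq_of_shared_node hdM heM (Or.inl rfl) (Or.inr h))
    have h3 : E ⊓ E.map T = ⊥ := by
      rw [eq_bot_iff]
      rintro _ ⟨h4, x, hx, rfl⟩
      have h5 := h4 d (Finset.mem_insert_self d D)
      have h6 := hx d (Finset.mem_insert_self d D)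
      rw [hT, Matrix.mulVecLin_apply, Matrix.mulVec_mulVec,
        dimerOp_mul_majorana_end (hM.1 d hdM).ne (Or.inl rfl), Matrix.neg_mulVec,
        ← Matrix.mulVec_mulVec, h6, Matrix.mulVec_smul, neg_eq_iff_add_eq_zero,
        ← add_smul] at h5
      exact (smul_eq_zero.mp h5).resolve_left (by simpa [← two_mul] using hμ d)
    have h4 := Submodule.finrank_sup_add_finrank_inf_eq E (E.map T)
    rw [h3, finrank_bot, add_zero, h1] at h4
    have h5 := Submodule.finrank_mono h2
    rw [Finset.card_insert_of_notMem hdD, pow_succ]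
    refine le_trans ?_ ih
    rw [mul_assoc]
    exact Nat.mul_le_mul_left _ (by omega)

/-- A dimer state is determined by its dimers and parities up to a factor. -/
theorem exists_smul_of_mem_dimerEigenspace {N : ℕ} {M : Finset (Dimer N)}
    (hM : IsDimerPairing M) {μ : Dimer N → ℂ} (hμ : ∀ d, μ d ≠ 0) {ψ φ : QState N}
    (hψ : ψ ∈ dimerEigenspace M μ) (hφ : φ ∈ dimerEigenspace M μ) (h0 : φ ≠ 0) :
    ∃ r : ℂ, ψ = r • φ := by
  have h1 := finrank_dimerEigenspace hM hμ M subset_rfl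
  rw [hM.card] at h1
  have h2 : Module.finrank ℂ (dimerEigenspace M μ) ≤ 1 := by
    have : 0 < 2 ^ N := by positivity
    nlinarith
  obtain ⟨v, hv⟩ := finrank_le_one_iff.mp h2
  obtain ⟨x, hx⟩ := hv ⟨ψ, hψ⟩
  obtain ⟨y, hy⟩ := hv ⟨φ, hφ⟩
  have hx' : x • (v : QState N) = ψ := congrArg Subtype.val hx
  have hy' : y • (v : QState N) = φ := congrArg Subtype.val hy
  have hy0 : y ≠ 0 := by
    rintro rfl
    exact h0 (by rw [← hy', zero_smul])
  exact ⟨x * y⁻¹, by rw [← hx', ← hy', smul_smul, inv_mul_cancel_right₀ hy0]⟩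

/-- A product of Majorana operators outside of an interval that flips the parities of given dimers
not contained in the interval. -/
theorem exists_parity_flip {N : ℕ} {M : Finset (Dimer N)} (hM : IsDimerPairing M)
    {A : Finset (Fin N)} (hA : (A : Set (Fin N)).OrdConnected) (D : Finset (Dimer N))
    (hD : D ⊆ M) (hDA : ∀ d ∈ D, ¬ d.Within A) :
    ∃ g : Fin N → Matrix (Fin 2) (Fin 2) ℂ,
      ((∀ i ∈ A, g i = 1) ∨ ∀ i ∈ A, g i = pauliZ) ∧ IsUnit (tensorOp g) ∧
      ∀ e ∈ M, dimerOp e * tensorOp g =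
        (if e ∈ D then -1 else 1 : ℂ) • (tensorOp g * dimerOp e) := by
  induction D using Finset.induction_on with
  | empty =>
    refine ⟨fun _ => 1, Or.inl fun _ _ => rfl, ?_, fun e _ => ?_⟩ <;> simp [tensorOp_one]
  | insert d D hdD ih =>
    obtain ⟨g, hg, hu, hS⟩ := ih ((Finset.subset_insert d D).trans hD)
      fun e he => hDA e (Finset.mem_insert_of_mem he)
    have hdM : d ∈ M := hD (Finset.mem_insert_self d D)
    -- A Majorana operator at an outside end of `d` flips the parity of `d` and of no other dimer of
    -- `M`.
    obtain ⟨k, hkd, hkA⟩ : ∃ k, (d.1 = k ∨ d.2 = k) ∧ site k ∉ A := by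
      by_contra! hc
      exact hDA d (Finset.mem_insert_self d D) ⟨hc _ (Or.inl rfl), hc _ (Or.inr rfl)⟩
    have hmul : tensorOp (fun i => majoranaFactor k i * g i) = majorana k * tensorOp g := by
      rw [majorana_eq, tensorOp_mul]
    refine ⟨fun i => majoranaFactor k i * g i, ?_, ?_, fun e he => ?_⟩
    · rcases majoranaFactor_const_on hA hkA with h1 | h1 <;> rcases hg with h2 | h2
      · exact Or.inl fun i hi => by simp only [h1 i hi, h2 i hi, one_mul]
      · exact Or.inr fun i hi => by simp only [h1 i hi, h2 i hi, one_mul]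
      · exact Or.inr fun i hi => by simp only [h1 i hi, h2 i hi, mul_one]
      · exact Or.inl fun i hi => by simp only [h1 i hi, h2 i hi, pauliZ_mul_self]
    · rw [hmul]
      exact (IsUnit.of_mul_eq_one _ (majorana_mul_self k)).mul hu
    · rw [hmul, ← mul_assoc]
      by_cases hed : e = d
      · subst hed
        rw [dimerOp_mul_majorana_end (hM.1 e he).ne hkd, neg_mul, mul_assoc, hS e he, mul_assoc]
        simp [hdD]
      · have hne : ¬ (e.1 = k ∨ e.2 = k) := fun h =>
          hed (hM.eq_of_shared_node he hdM h hkd)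
        push Not at hne
        rw [dimerOp_mul_majorana hne.1 hne.2, mul_assoc, hS e he, mul_assoc, Matrix.mul_smul]
        simp [hed]

/-! ### Recovery -/

/-- `W` is the recovered matrix unit `|b'⟩⟨b|` on `a`. For `b' = b` it acts on the code states as
the projector onto the value of `b` on `a`. -/
theorem Recoverable.exists_transfer {m N : ℕ} {V : Matrix (Config (Fin N)) (Config (Fin m)) ℂ}
    {A : Finset (Fin N)} {a : Finset (Fin m)} (h : Recoverable V A a) {b b' : Config (Fin m)}
    (hb : ∀ i, i ∉ a → b' i = b i) :
    ∃ W : Matrix (Config A) (Config A) ℂ,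
      extendOp A W *ᵥ (fun s => V s b) = (fun s => V s b') ∧
      ∀ x : Config (Fin m), (∃ i ∈ a, x i ≠ b i) → extendOp A W *ᵥ (fun s => V s x) = 0 := by
  obtain ⟨ι, _, hι⟩ := h
  set O : Matrix (Config a) (Config a) ℂ :=
    Matrix.single (fun i => b' i) (fun i => b i) 1 with hO
  have key : ∀ x s, (extendOp A (ι O) *ᵥ (fun s => V s x)) s =
      ∑ t, V s t * extendOp a O t x := by
    intro x s
    exact congrFun (congrFun (hι O) s) x
  refine ⟨ι O, funext fun s => ?_, fun x hx => funext fun s => ?_⟩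
  · rw [key, Finset.sum_eq_single b']
    · rw [extendOp, Matrix.of_apply, if_pos hb, hO, Matrix.single_apply_same, mul_one]
    · intro t _ ht
      rw [extendOp, Matrix.of_apply]
      split_ifs with h1
      · rw [hO, Matrix.single_apply, if_neg, mul_zero]
        rintro ⟨h2, _⟩
        refine ht (funext fun i => ?_)
        by_cases hi : i ∈ a
        · exact (congrFun h2 ⟨i, hi⟩).symm
        · rw [h1 i hi, hb i hi]
      · exact mul_zero _
    · exact fun h => absurd (Finset.mem_univ _) h
  · obtain ⟨i, hi, hne⟩ := hx
    rw [key, Pi.zero_apply]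
    refine Finset.sum_eq_zero fun t _ => ?_
    rw [extendOp, Matrix.of_apply]
    split_ifs
    · rw [hO, Matrix.single_apply, if_neg, mul_zero]
      rintro ⟨_, h2⟩
      exact hne (congrFun h2 ⟨i, hi⟩).symm
    · exact mul_zero _

/-- Dimers within the region `A` see only the entanglement wedge of `A`. -/
theorem parity_eq_of_agree {m N : ℕ} {V : Matrix (Config (Fin N)) (Config (Fin m)) ℂ}
    {A : Finset (Fin N)} (hA : (A : Set (Fin N)).OrdConnected) {a : Finset (Fin m)}
    (h : Recoverable V Aᶜ aᶜ) {M : Finset (Dimer N)} {p : Config (Fin m) → Dimer N → ℤˣ}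
    (hp : ∀ b, IsDimerState (fun s => V s b) M (p b)) {b b' : Config (Fin m)}
    (hb : ∀ t ∈ a, b t = b' t) {d : Dimer N} (hd : d ∈ M) (hdA : d.Within A) :
    p b d = p b' d := by
  obtain ⟨W, hW, _⟩ := h.exists_transfer (b := b) (b' := b')
    fun i hi => (hb i (by simpa using hi)).symm
  -- The strings of a dimer inside the interval cancel outside it, so its bilinear is trivial on the
  -- support of `W`.
  have hcomm : extendOp Aᶜ W * dimerOp d = dimerOp d * extendOp Aᶜ W := by
    rw [dimerOp, majorana_eq, majorana_eq, tensorOp_mul]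
    exact extendOp_commute_tensorOp W fun i hi =>
      majoranaFactor_mul_eq_one hA hdA (by simpa using hi)
  have h1 := (hp b').dimerOp_mulVec hd
  rw [← hW, Matrix.mulVec_mulVec, ← hcomm, ← Matrix.mulVec_mulVec, (hp b).dimerOp_mulVec hd,
    Matrix.mulVec_smul, hW] at h1
  have h2 := smul_left_injective ℂ (hp b').1 h1
  have h3 := mul_left_cancel₀ Complex.I_ne_zero h2
  exact Units.ext (by exact_mod_cast h3)

/-- The parities of the dimers within the region `A` determine the basis state of its entanglement
wedge. -/
theorem agree_of_parity_eq {m N : ℕ} {V : Matrix (Config (Fin N)) (Config (Fin m)) ℂ}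
    {A : Finset (Fin N)} (hA : (A : Set (Fin N)).OrdConnected) {a : Finset (Fin m)}
    (h : Recoverable V A a) {M : Finset (Dimer N)} {p : Config (Fin m) → Dimer N → ℤˣ}
    (hp : ∀ b, IsDimerState (fun s => V s b) M (p b))
    (hpar : ∀ b, ∃ q : ℂ, q ≠ 0 ∧
      tensorOp (fun _ => pauliZ) *ᵥ (fun s => V s b) = q • fun s => V s b)
    {b b' : Config (Fin m)} (heq : ∀ d ∈ M, d.Within A → p b d = p b' d) {t : Fin m}
    (ht : t ∈ a) : b t = b' t := by
  by_contra hne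
  -- The recovered projector onto `b` on `a`: it fixes `V|b⟩` and kills `V|b'⟩`.
  obtain ⟨W, hW, hW'⟩ := h.exists_transfer (b := b) (b' := b) fun _ _ => rfl
  have hW0 := hW' b' ⟨t, ht, Ne.symm hne⟩
  have hM := (hp b).2.1
  obtain ⟨g, hg, hu, hS⟩ := exists_parity_flip hM hA (M.filter fun d => p b d ≠ p b' d)
    (Finset.filter_subset _ _) fun d hd hdA =>
      (Finset.mem_filter.mp hd).2 (heq d (Finset.mem_filter.mp hd).1 hdA)
  -- After the flips `V|b⟩` has all the parities of `V|b'⟩`, and these determine the state up to a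
  -- factor.
  obtain ⟨r, hr⟩ : ∃ r : ℂ, tensorOp g *ᵥ (fun s => V s b) = r • fun s => V s b' := by
    refine exists_smul_of_mem_dimerEigenspace hM (μ := fun d => Complex.I * ((p b' d : ℤ) : ℂ))
      (fun d => mul_ne_zero Complex.I_ne_zero (by exact_mod_cast (p b' d).ne_zero))
      (fun d hd => ?_) (fun d hd => (hp b').dimerOp_mulVec hd) (hp b').1
    rw [Matrix.mulVec_mulVec, hS d hd, Matrix.smul_mulVec, ← Matrix.mulVec_mulVec,
      (hp b).dimerOp_mulVec hd, Matrix.mulVec_smul, smul_smul]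
    congr 1
    by_cases hd' : p b d = p b' d
    · simp [hd']
    · have h1 : p b d = -p b' d := by
        rcases Int.units_eq_one_or (p b d) with h1 | h1 <;>
          rcases Int.units_eq_one_or (p b' d) with h2 | h2 <;> simp_all
      simp [hd, h1]
  obtain ⟨q, hq, hZ⟩ := hpar b
  -- If the flip operator is `Z` throughout `A`, multiplying by the total parity makes it trivial on
  -- `A` at the cost of the nonzero factor `q`.
  obtain ⟨f, x, hf, hx, hfx⟩ : ∃ (f : Fin N → Matrix (Fin 2) (Fin 2) ℂ) (x : ℂ),
      (∀ i ∈ A, f i = 1) ∧ x ≠ 0 ∧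
      tensorOp f *ᵥ (fun s => V s b) = x • (tensorOp g *ᵥ (fun s => V s b)) := by
    rcases hg with hg | hg
    · exact ⟨g, 1, hg, one_ne_zero, (one_smul _ _).symm⟩
    · refine ⟨fun i => g i * pauliZ, q, fun i hi => by simp only [hg i hi, pauliZ_mul_self], hq, ?_⟩
      rw [← tensorOp_mul, ← Matrix.mulVec_mulVec, hZ, Matrix.mulVec_smul]
  -- The projector on `A` commutes with an operator trivial on `A`, so it fixes the image of `V|b⟩`.
  -- That image is a multiple of `V|b'⟩`, which the projector kills, so it vanishes, contradicting
  -- invertibility of the flip operator.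
  have h1 : extendOp A W *ᵥ (tensorOp f *ᵥ fun s => V s b) = tensorOp f *ᵥ fun s => V s b := by
    rw [Matrix.mulVec_mulVec, extendOp_commute_tensorOp W hf, ← Matrix.mulVec_mulVec, hW]
  rw [hfx, hr, Matrix.mulVec_smul, Matrix.mulVec_smul, hW0, smul_zero, smul_zero, ← hr,
    eq_comm, smul_eq_zero] at h1
  have h2 := h1.resolve_left hx
  obtain ⟨u, hu⟩ := hu
  refine (hp b).1 ?_
  rw [← Matrix.one_mulVec (fun s => V s b), ← u.inv_mul, hu, ← Matrix.mulVec_mulVec, h2,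
    Matrix.mulVec_zero]

end HaPPY

/-! ### Dimers within a boundary interval and its entanglement wedge -/

theorem theorem4 {m : ℕ} {c : List ℕ} (P : HaPPY.Patch m c)
    (A : Finset (Fin c.length)) (hA : (A : Set (Fin c.length)).OrdConnected)
    (a : Finset (Fin m)) (ha : HaPPY.IsEntanglementWedge P.encoding A a) :
    ∃ (M : Finset (HaPPY.Dimer c.length))
      (p : HaPPY.Config (Fin m) → HaPPY.Dimer c.length → ℤˣ),
      (∀ b, HaPPY.IsDimerState (P.codeState b) M (p b)) ∧
      ∃ L ⊆ M, (∀ d ∈ L, d.Within A) ∧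
        ∀ b b' : HaPPY.Config (Fin m),
          (∀ d ∈ L, p b d = p b' d) ↔ (∀ t ∈ a, b t = b' t) := by
  classical
  obtain ⟨σ, hσ, h⟩ := P.exists_pairing
  choose p hp using fun b => (h b).exists_isDimerState hσ
  -- `L` is the set of all dimers within `A`. Recovery on `A` shows that their parities determine
  -- `b` on `a`; recovery on `Aᶜ` shows that they depend on nothing else.
  refine ⟨HaPPY.pairingDimers c.length σ, p, hp,
    (HaPPY.pairingDimers c.length σ).filter fun d => d.Within A, Finset.filter_subset _ _,
    fun d hd => (Finset.mem_filter.mp hd).2, fun b b' => ⟨fun heq t ht => ?_, fun hb d hd => ?_⟩⟩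
  · exact HaPPY.agree_of_parity_eq (V := P.encoding) hA ha.1 hp
      (fun b => (h b).parity.tensorOp_mulVec)
      (fun d hd hdA => heq d (Finset.mem_filter.mpr ⟨hd, hdA⟩)) ht
  · obtain ⟨hd, hdA⟩ := Finset.mem_filter.mp hd
    exact HaPPY.parity_eq_of_agree (V := P.encoding) hA ha.2 hp hb hd hdA
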